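/- **Setting.** Let $\mathcal M$ be a finite average-reward Markov decision process with nonempty state set $\mathcal S$, nonempty finite action sets $\mathcal A_i$ $(i\in\mathcal S)$, state-action pairs $(i,a_i)\in\mathcal A$, $A_{\rm tot}=|\mathcal A|$, transition laws $\mathbf P_{(i,a_i)}$ and rewards $r_{(i,a_i)}\in[0,1]$. A policy $\pi$ assigns to every state $i$ a probability vector on $\mathcal A_i$; $\mathbf P^\pi$ is the transition matrix of its chain of states, and $\bar v^\pi=\lim_{T\to\infty}\mathbb E_\pi\big[\frac1T\sum_{t=1}^T r_{i_t,a_t}\big]$ (for every initial law) is its average reward. A policy $\pi$ is $\varepsilon$-optimal if $\bar v^{\pi}\ge\bar v^{\pi'}-\varepsilon$ for all policies $\pi'$. Assume that $\mathcal M$ is mixing: with $\nu^\pi$ the stationary law of $\mathbf P^\pi$, $$t_{\rm mix}=\max_\pi\ \min\Big\{t\ge1:\ \max_{q}\big\|((\mathbf P^\pi)^{\top})^t q-\nu^\pi\big\|_1\le \tfrac12\Big\}<\infty .$$ $\mathbf P$ is accessible only through a generative model, which on request returns an independent sample of $\mathbf P_{(i,a_i)}$ for a chosen pair. **Algorithm.**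 Input: $\varepsilon>0$, $\sigma\in(0,1/2)$, $n$, $N$. *Preprocessing* (accuracy $\delta'=\varepsilon/16$, confidence $\sigma'=\sigma/2$): draw $n$ samples of each pair and let $\widetilde{\mathbf P}_{(i,a_i)}$ be their empirical distribution, where $$n\ \ge\ C_0\, t_{\rm mix}^2\,\frac{|\mathcal S|+\log(A_{\rm tot}/\sigma')}{\delta'^2}.$$ *Main loop*: put $\eta=\varepsilon/64$, $\mathcal X=[0,1]\times[-4t_{\rm mix},4t_{\rm mix}]^{\mathcal S}$ and $(\bar v^0,h^0)=(0,0)$. In iteration $k=0,\dots,N-1$ let $g_{(i,a_i)}=r_{(i,a_i)}-\bar v^k+\langle\widetilde{\mathbf P}_{(i,a_i)},h^k\rangle-h^k_i$. If $\max_{\mathcal A} g\le \varepsilon/16+\varepsilon/16$, the step is productive and $(\bar v^{k+1},h^{k+1})=\Pi_{\mathcal X}(\bar v^k-\eta,\,h^k)$. Otherwise the step is non-productive: choose $(i,a_i)_k\in\operatorname{argmax}g$, draw a fresh sample $s\sim\mathbf P_{(i,a_i)_k}$, and put $(\bar v^{k+1},h^{k+1})=\Pi_{\mathcal X}\big(\bar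 v^k+\eta,\;h^k-\eta(e_s-e_i)\big)$. Here $\Pi_{\mathcal X}$ is the Euclidean projection onto the box $\mathcal X$. Let $I$ and $J$ be the sets of productive and non-productive steps. *Output*: $\hat\mu_{(i,a_i)}=\frac1{|I|}\#\{k\in J:(i,a_i)_k=(i,a_i)\}$ and $\hat\pi_{i,a_i}=\hat\mu_{(i,a_i)}/\sum_{b\in\mathcal A_i}\hat\mu_{(i,b)}$ (the $i$-th block is that of an arbitrary fixed policy where this is undefined). **Implementation and cost.** A head node stores $\bar v,h$; there is one node for each pair $(j,a_j)$, storing its current constraint value $g_{(j,a_j)}$ and its row of $\widetilde{\mathbf P}$. In each iteration the head obtains the maximal constraint value, performs the step (requesting one sample from one node if the step is non-productive), and broadcasts the at most three changed coordinates, from which every node updates its constraint value. The nodes are distributed evenly among $m\le A_{\rm tot}$ workers, at most $\lceil A_{\rm tot}/m\rceil$ on each. One unit of time is one elementary operation on a processor (real arithmetic, comparison, memory access, sending or receiving one word, drawing one sample); broadcasting one word, and combining the maxima computed by the workers, are elementary operations of the network. The parallel depth is the largest elapsed time of a single iteration if each node has its own processor. Costs are those after the preprocessing. **Theorem 3.**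 There are universal constants $C_0,C,K>0$ such that for all such $\mathcal M$, $\varepsilon>0$, $\sigma\in(0,1/2)$, every $n$ as above and every way to break ties in the argmax: 1. if $N\ge C\,t_{\rm mix}^2|\mathcal S|\log(1/\sigma)/\varepsilon^2$, then $\hat\pi$ is an $\varepsilon$-optimal policy with probability at least $1-\sigma$; 2. for every $N\ge1$, every run has parallel depth at most $K$, and uses at most $K A_{\rm tot}N$ samples and $K A_{\rm tot}N$ elementary operations in total; with $m\le A_{\rm tot}$ workers it takes at most $K\frac{A_{\rm tot}}m N$ units of real time; 3. in particular, if $\varepsilon\le1$ and $N=\lceil C\,t_{\rm mix}^2|\mathcal S|\log(1/\sigma)/\varepsilon^2\rceil$, the real time with $m\le A_{\rm tot}$ workers is at most $K\frac{A_{\rm tot}}m\,t_{\rm mix}^2|\mathcal S|\log(1/\sigma)\,\varepsilon^{-2}$. -/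

import Mathlib

open scoped Topology Matrix Finset

noncomputable section

/-! ## Average-reward Markov decision processes -/

/-- State-action pairs `(i, a_i)`; `p.1` is the state of the pair `p`. -/
abbrev Pair {S : Type} (A : S → Type) : Type := Σ i : S, A i

/-- A finite MDP: `P p` is the law of the next state after the pair `p`, `r p ∈ [0, 1]` is its
instant reward. -/
structure AMDP (S : Type) [Fintype S] (A : S → Type) where
  P : Pair A → S → ℝ
  r : Pair A → ℝ
  P_mem : ∀ p, P p ∈ stdSimplex ℝ S
  r_mem : ∀ p, r p ∈ Set.Icc (0 : ℝ) 1

/-- A stationary randomized policy: for every state a probability vector over its actions. -/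
def IsPolicy {S : Type} {A : S → Type} [∀ i, Fintype (A i)] (π : Pair A → ℝ) : Prop :=
  ∀ i, (fun a : A i => π ⟨i, a⟩) ∈ stdSimplex ℝ (A i)

namespace AMDP

variable {S : Type} [Fintype S] [DecidableEq S] {A : S → Type} [∀ i, Fintype (A i)]

/-- The transition matrix `P^π` of the Markov chain of states under `π`. -/
def trans (M : AMDP S A) (π : Pair A → ℝ) : Matrix S S ℝ :=
  Matrix.of fun i j => ∑ a : A i, π ⟨i, a⟩ * M.P ⟨i, a⟩ j

/-- The expected instant reward `r^π` in each state under `π`. -/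
def reward (M : AMDP S A) (π : Pair A → ℝ) (i : S) : ℝ :=
  ∑ a : A i, π ⟨i, a⟩ * M.r ⟨i, a⟩

/-- `v` is the average reward of `π`: the limit of the expected average reward of the first `T`
steps, for every initial law `q` (the law of the `t`-th state is `q (P^π)^t`, counting from 0). -/
def IsAverageReward (M : AMDP S A) (π : Pair A → ℝ) (v : ℝ) : Prop :=
  ∀ q ∈ stdSimplex ℝ S,
    Filter.Tendsto (fun T : ℕ => (∑ t ∈ Finset.range T, (q ᵥ* (M.trans π) ^ t) ⬝ᵥ M.reward π) / (T : ℝ))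
      Filter.atTop (𝓝 v)

/-- `π` is a policy whose average reward is within `ε` of that of every policy. -/
def IsEpsOptimal (M : AMDP S A) (ε : ℝ) (π : Pair A → ℝ) : Prop :=
  IsPolicy π ∧ ∃ v, M.IsAverageReward π v ∧
    ∀ π', IsPolicy π' → ∃ v', M.IsAverageReward π' v' ∧ v' ≤ v + ε

/-- After `t` steps the chain of `π` is, from every initial law, within `ℓ₁`-distance `1/2` of a
stationary law `ν`. (For `t ≥ 1` this makes `ν` the only stationary law.) -/
def MixedAt (M : AMDP S A) (π : Pair A → ℝ) (t : ℕ) : Prop :=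
  ∃ ν ∈ stdSimplex ℝ S, ν ᵥ* M.trans π = ν ∧
    ∀ q ∈ stdSimplex ℝ S, ∑ j, |(q ᵥ* (M.trans π) ^ t) j - ν j| ≤ 1 / 2

/-- The mixing time of one policy: the least `t ≥ 1` at which its chain is mixed. -/
def policyMixTime (M : AMDP S A) (π : Pair A → ℝ) : ℕ := sInf {t | 1 ≤ t ∧ M.MixedAt π t}

/-- The mixing time of the MDP: the maximum over all policies. -/
def tmix (M : AMDP S A) : ℕ := sSup {t | ∃ π, IsPolicy π ∧ t = M.policyMixTime π}

/-- Every policy has a mixing time, and these are bounded (so that `tmix` is a maximum). -/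
def Mixing (M : AMDP S A) : Prop :=
  (∀ π, IsPolicy π → ∃ t, 1 ≤ t ∧ M.MixedAt π t) ∧
    BddAbove {t | ∃ π, IsPolicy π ∧ t = M.policyMixTime π}

/-- A generative model for `M`: the variables `X (p, l)`, the `l`-th answers of the sampler to the
pairs `p`, are independent, and `X (p, l)` has the law `M.P p`. -/
def IsSampler {Ω : Type*} [MeasurableSpace Ω] [MeasurableSpace S] (M : AMDP S A)
    (μ : MeasureTheory.Measure Ω) (X : Pair A × ℕ → Ω → S) : Prop :=
  (∀ q, Measurable (X q)) ∧ ProbabilityTheory.iIndepFun X μ ∧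
    ∀ p l s, μ.real {ω | X (p, l) ω = s} = M.P p s

end AMDP

/-- Preprocessing: the empirical transition matrix of the first `n` answers for every pair. -/
def empirical {S : Type} [DecidableEq S] {A : S → Type} (n : ℕ) (Y : Pair A × ℕ → S)
    (p : Pair A) (s : S) : ℝ :=
  (1 / (n : ℝ)) * ∑ l ∈ Finset.range n, if Y (p, l) = s then 1 else 0

/-! ## The cost model

A head node and one logical node for each state-action pair; the logical nodes are hosted by `m`
workers. A processor performs one elementary operation (real arithmetic, a comparison, a memory
access, sending or receiving one word, drawing one sample) per unit of time; the logical nodes on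
one worker are served one after another, different workers work simultaneously. A broadcast of one
word by the head, and combining the values of the workers into their maximum, are elementary
operations of the network. Memory is initially zero. -/

/-- A local computation on one processor, with its number of elementary operations. -/
structure Timed (α : Type) where
  val : α
  ops : ℕ

instance : Monad Timed where
  pure x := ⟨x, 0⟩
  bind x f := ⟨(f x.val).val, x.ops + (f x.val).ops⟩

namespace Timed

/-- One elementary operation with result `x`. -/
def tick {α : Type} (x : α) : Timed α := ⟨x, 1⟩

def add (x y : ℝ) : Timed ℝ := tick (x + y)
def sub (x y : ℝ) : Timed ℝ := tick (x - y)
def mul (x y : ℝ) : Timed ℝ := tick (x * y)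
def div (x y : ℝ) : Timed ℝ := tick (x / y)
def min (x y : ℝ) : Timed ℝ := tick (Min.min x y)
def max (x y : ℝ) : Timed ℝ := tick (Max.max x y)
def le (x y : ℝ) : Timed Bool := tick (decide (x ≤ y))
def eq {α : Type} [DecidableEq α] (x y : α) : Timed Bool := tick (decide (x = y))

/-- Reading and writing one cell of an array. -/
def load {ι : Type} (f : ι → ℝ) (i : ι) : Timed ℝ := tick (f i)
def store {ι : Type} [DecidableEq ι] (f : ι → ℝ) (i : ι) (x : ℝ) : Timed (ι → ℝ) :=
  tick (Function.update f i x)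

/-- Projection of a number onto the interval `[lo, hi]`. -/
def clip (lo hi x : ℝ) : Timed ℝ := do
  let y ← min hi x
  max lo y

/-- The number 1 if the condition holds, and 0 otherwise. -/
def ind (b : Bool) : Timed ℝ := tick (if b then 1 else 0)

end Timed

/-- `work`: all elementary operations; `samples`: drawn samples; `depth`: elapsed time if every
logical node has a processor of its own; `time`: elapsed time with the given workers. -/
structure Cost where
  work : ℕ
  samples : ℕ
  depth : ℕ
  time : ℕ

namespace Cost

/-- The cost of two consecutive parts of one iteration. -/
def seq (x y : Cost) : Cost :=
  ⟨x.work + y.work, x.samples + y.samples, x.depth + y.depth, x.time + y.time⟩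

/-- The cost of consecutive iterations: `depth` is the largest depth of an iteration. -/
def next (x y : Cost) : Cost :=
  ⟨x.work + y.work, x.samples + y.samples, Max.max x.depth y.depth, x.time + y.time⟩

end Cost

/-- A computation on the network, with its cost. -/
structure Net (α : Type) where
  val : α
  cost : Cost

instance : Monad Net where
  pure x := ⟨x, ⟨0, 0, 0, 0⟩⟩
  bind x f := ⟨(f x.val).val, x.cost.seq (f x.val).cost⟩

namespace Net

variable {ι : Type} [Fintype ι] {m : ℕ}

/-- A local computation on the head, or on one node while the others wait. -/
def onOne {α : Type} (t : Timed α) : Net α := ⟨t.val, ⟨t.ops, 0, t.ops, t.ops⟩⟩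

/-- A local computation on every node; node `a` is hosted by the worker `host a`. -/
def onAll {α : Type} (host : ι → Fin m) (t : ι → Timed α) : Net (ι → α) :=
  ⟨fun a => (t a).val,
    ⟨∑ a, (t a).ops, 0, Finset.univ.sup fun a => (t a).ops,
      Finset.univ.sup fun w : Fin m => ∑ a with host a = w, (t a).ops⟩⟩

/-- The head sends one word to all nodes. -/
def broadcast {α : Type} (host : ι → Fin m) (x : α) : Net α := do
  let y ← onOne (Timed.tick x)
  let _ ← onAll host fun _ => Timed.tick y
  return y

/-- The head learns a pair at which the values of the nodes are maximal: every worker updates its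
running maximum once for each of its nodes, and the maxima of the workers are combined. -/
def argmax (host : ι → Fin m) (sel : (ι → ℝ) → ι) (g : ι → ℝ) : Net ι := do
  let _ ← onAll host fun a => Timed.tick (g a)
  onOne (Timed.tick (sel g))

/-- One call of the sampler, with the answer `s`. -/
def sample {α : Type} (s : α) : Net α := ⟨s, ⟨1, 1, 1, 1⟩⟩

end Net

/-! ## The parallel algorithm -/

/-- The memory of the node of a pair `(j, a_j)`: the current approximate constraint value, the
number of times that the pair was sampled, the number of non-productive steps at the state `j`, and
the number of productive steps. -/
structure NodeMem where
  c : ℝ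
  cnt : ℝ
  vis : ℝ
  prod : ℝ

/-- The memory of the network: the primal variables `v`, `h` on the head, and the nodes. -/
structure NetMem {S : Type} (A : S → Type) where
  v : ℝ
  h : S → ℝ
  node : Pair A → NodeMem

section Algorithm

variable {S : Type} [Fintype S] [DecidableEq S] {A : S → Type} [∀ i, Fintype (A i)]
  [∀ i, DecidableEq (A i)] {m : ℕ}

/-- Update of a node after a productive step that changed `v` by `dv`. -/
def productiveUpdate (x : NodeMem) (dv : ℝ) : Timed NodeMem := do
  let c ← Timed.sub x.c dv
  let prod ← Timed.add x.prod 1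
  return { x with c := c, prod := prod }

/-- Update of the node of `b` after a non-productive step at the pair `a` with state `i` and sample
`s`, that changed `v`, `h_i`, `h_s` by `dv`, `di`, `ds`; `row` is the node's row of the estimated
transition matrix. -/
def nonproductiveUpdate (row : S → ℝ) (b a : Pair A) (x : NodeMem) (i s : S) (dv di ds : ℝ) :
    Timed NodeMem := do
  let eqi ← Timed.eq b.1 i
  let eqs ← Timed.eq b.1 s
  let eqa ← Timed.eq b a
  let oi ← Timed.ind eqi
  let os ← Timed.ind eqs
  let oa ← Timed.ind eqa
  let ri ← Timed.load row i
  let rs ← Timed.load row s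
  let ki ← Timed.sub ri oi
  let ks ← Timed.sub rs os
  let ti ← Timed.mul ki di
  let ts ← Timed.mul ks ds
  let c₁ ← Timed.sub x.c dv
  let c₂ ← Timed.add c₁ ti
  let c₃ ← Timed.add c₂ ts
  let cnt ← Timed.add x.cnt oa
  let vis ← Timed.add x.vis oi
  return { x with c := c₃, cnt := cnt, vis := vis }

/-- The head's computation in a productive step: the new `v` and its change `dv`. -/
def headProductive (η v : ℝ) : Timed (ℝ × ℝ) := do
  let v₁ ← Timed.sub v η
  let v' ← Timed.clip 0 1 v₁
  let dv ← Timed.sub v' v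
  return (v', dv)

/-- The new `v` and its change `dv` in a non-productive step. -/
def headNonproductiveV (η v : ℝ) : Timed (ℝ × ℝ) := do
  let v₁ ← Timed.add v η
  let v' ← Timed.clip 0 1 v₁
  let dv ← Timed.sub v' v
  return (v', dv)

/-- The projection onto `[-B, B]^S` of `h - η (e_s - e_i)`, and the changes `di`, `ds` of its
coordinates `i` and `s`, in a non-productive step at the state `i` with the sample `s`. -/
def headNonproductiveH (η B : ℝ) (h : S → ℝ) (i s : S) : Timed ((S → ℝ) × ℝ × ℝ) := do
  let same ← Timed.eq s i
  let d ← Timed.tick (if same then 0 else η)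
  let hi ← Timed.load h i
  let hs ← Timed.load h s
  let hi₁ ← Timed.add hi d
  let hs₁ ← Timed.sub hs d
  let hi' ← Timed.clip (-B) B hi₁
  let hs' ← Timed.clip (-B) B hs₁
  let di ← Timed.sub hi' hi
  let ds ← Timed.sub hs' hs
  let h₁ ← Timed.store h i hi'
  let h' ← Timed.store h₁ s hs'
  return (h', di, ds)

/-- A productive step. -/
def productiveStep (η : ℝ) (host : Pair A → Fin m) (x : NetMem A) : Net (NetMem A) := do
  let y ← Net.onOne (headProductive η x.v)
  let dv ← Net.broadcast host y.2
  let node ← Net.onAll host fun b => productiveUpdate (x.node b) dv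
  return { x with v := y.1, node := node }

/-- A non-productive step at the pair `a`. -/
def nonproductiveStep (η B : ℝ) (host : Pair A → Fin m) (Pt : Pair A → S → ℝ)
    (smp : Pair A → S) (a : Pair A) (x : NetMem A) : Net (NetMem A) := do
  let a ← Net.onOne (Timed.tick a)
  let s ← Net.sample (smp a)
  let s ← Net.onOne (Timed.tick s)
  let i ← Net.onOne (Timed.tick a.1)
  let y ← Net.onOne (headNonproductiveV η x.v)
  let z ← Net.onOne (headNonproductiveH η B x.h i s)
  let i ← Net.broadcast host i
  let s ← Net.broadcast host s
  let dv ← Net.broadcast host y.2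
  let di ← Net.broadcast host z.2.1
  let ds ← Net.broadcast host z.2.2
  let node ← Net.onAll host fun b =>
    nonproductiveUpdate (Pt b) b a (x.node b) i s dv di ds
  return { v := y.1, h := z.1, node := node }

/-- One iteration, with step size `η`, threshold `thr` for the constraints, and the search space
`[0, 1] × [-B, B]^S`: the iterate moves against the stochastic subgradient and is projected back onto
the search space, which is the mirror step for half the squared Euclidean norm. `Pt` is the estimated transition matrix,
`smp a` is the answer of the sampler should the pair `a` be sampled in this iteration. As long as no
coordinate is clipped, `dv = -η` in a productive step, and `dv = η`, `di = η`, `ds = -η` in a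
non-productive step with `s ≠ i`. -/
def iteration (η thr B : ℝ) (host : Pair A → Fin m) (sel : (Pair A → ℝ) → Pair A)
    (Pt : Pair A → S → ℝ) (smp : Pair A → S) (x : NetMem A) : Net (NetMem A) := do
  Net.broadcast host ()
  let g ← Net.onAll host fun a => Timed.tick (x.node a).c
  let a ← Net.argmax host sel g
  let ok ← Net.onOne (Timed.le (g a) thr)
  if ok then productiveStep η host x else nonproductiveStep η B host Pt smp a x

/-- The initial memory: `v = 0`, `h = 0`, and every node stores its reward as constraint value. -/
def initMem (host : Pair A → Fin m) (r : Pair A → ℝ) : Net (NetMem A) := do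
  let node ← Net.onAll host fun a => (do
    let c ← Timed.load r a
    return { c := c, cnt := 0, vis := 0, prod := 0 } : Timed NodeMem)
  return { v := 0, h := fun _ => 0, node := node }

/-- The output: with `μ_{i,a}` the number of samples of the pair, and `λ_i` the number of samples at
its state, both divided by the number of productive steps, node `(i, a)` returns `μ_{i,a} / λ_i`. If
`λ_i` is zero or undefined, it returns the entry of a default policy. -/
def extractPolicy (host : Pair A → Fin m) (π₀ : Pair A → ℝ) (x : NetMem A) :
    Net (Pair A → ℝ) :=
  Net.onAll host fun a => do
    let mu ← Timed.div (x.node a).cnt (x.node a).prod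
    let lam ← Timed.div (x.node a).vis (x.node a).prod
    let zero ← Timed.eq lam 0
    if zero then Timed.load π₀ a else Timed.div mu lam

/-- The first `N` iterations; iteration `k` takes its sample from the answers number `n + k`. -/
def iterates (η thr B : ℝ) (host : Pair A → Fin m) (sel : (Pair A → ℝ) → Pair A)
    (r : Pair A → ℝ) (Pt : Pair A → S → ℝ) (n : ℕ) (Y : Pair A × ℕ → S) : ℕ → Net (NetMem A)
  | 0 => initMem host r
  | k + 1 =>
    let x := iterates η thr B host sel r Pt n Y k
    let y := iteration η thr B host sel Pt (fun a => Y (a, n + k)) x.val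
    ⟨y.val, x.cost.next y.cost⟩

/-- The parallel algorithm for the accuracy `ε`, with `n` samples of each pair in the preprocessing
and `N` iterations, on the sampler's answers `Y`. The constraints are checked against `ε' + δ`
with `ε' = δ = ε / 16`, and the step size is `ε' / 4`. The cost is that of the algorithm after the
preprocessing. -/
def parallelAMDP (M : AMDP S A) (ε : ℝ) (n N : ℕ) (host : Pair A → Fin m)
    (sel : (Pair A → ℝ) → Pair A) (π₀ : Pair A → ℝ) (Y : Pair A × ℕ → S) : Net (Pair A → ℝ) :=
  let x := iterates (ε / 64) (ε / 16 + ε / 16) (4 * M.tmix) host sel M.r (empirical n Y) n Y N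
  let y := extractPolicy host π₀ x.val
  ⟨y.val, x.cost.next y.cost⟩

end Algorithm

end

/-! ## Geometric mixing of stochastic matrices -/

section Stochastic

variable {S : Type} [Fintype S]

/-! The iteration is constrained stochastic mirror descent for the average-reward linear program:
minimise `v` subject to `r a - v + ⟨P a, h⟩ - h i ≤ 0` for every pair `a` at a state `i`. The
potential is the squared distance of `(v, h)` from a comparator in the box, and two facts drive
`regret_bound`. At a productive step all true constraints are at most `3δ`, so by weak duality
(`stationary_reward_le`) `v` is at least the gain of any policy minus `3δ`. At a non-productive step
the sampled constraint is truly at least `δ`, so progress of order `δ` is made.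

The decisive choice is the comparator: the gain `v` and bias `h` of the output policy itself. They
solve its Poisson equation at every state, so the constraint values at `(v, h)`, weighted by the
counts, sum to zero (`sum_cnt_mul_violation_eq_zero`). The counts need not be close to stationary.
With `I` and `J` the numbers of productive and non-productive steps, what remains is `I (v' - 3δ -
v) + δ J ≤ (5/128) ε N` for the gain `v'` of any policy. As `5/128 < 1/16`, the term `δ J` absorbs
the share of `J` on the right, hence `I > 0` and `v' ≤ v + ε`. Mixing enters through `exists_bias`,
which puts the bias in the box of radius `4 tmix`.

This comparator depends on all the samples, so the noise must be bounded uniformly over the box. The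
noise is affine in the comparator, so the `2 ^ |S|` vertices suffice, and a union bound over
Azuma–Hoeffding estimates costs only an exponent of order `|S|`. The same reduction controls the
empirical transition laws.

The cost bounds are a count: in one iteration every node, and the head, performs a bounded number of
elementary operations. -/

theorem sum_vecMul_of_row_sum {P : Matrix S S ℝ} (h : ∀ i, ∑ j, P i j = 1) (x : S → ℝ) :
    ∑ j, (x ᵥ* P) j = ∑ i, x i := by
  simp only [Matrix.vecMul, dotProduct]
  rw [Finset.sum_comm]
  simp [← Finset.mul_sum, h]

theorem sum_abs_vecMul_le {P : Matrix S S ℝ} (h0 : ∀ i j, 0 ≤ P i j) (h : ∀ i, ∑ j, P i j = 1)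
    (x : S → ℝ) : ∑ j, |(x ᵥ* P) j| ≤ ∑ i, |x i| := by
  rw [← sum_vecMul_of_row_sum h (fun i => |x i|)]
  refine Finset.sum_le_sum fun j _ => ?_
  simp only [Matrix.vecMul, dotProduct]
  refine (Finset.abs_sum_le_sum_abs _ _).trans (le_of_eq ?_)
  simp [abs_mul, abs_of_nonneg (h0 _ _)]

theorem sum_abs_sub_le_two {q q' : S → ℝ} (hq : q ∈ stdSimplex ℝ S) (hq' : q' ∈ stdSimplex ℝ S) :
    ∑ j, |q j - q' j| ≤ 2 := by
  calc ∑ j, |q j - q' j| ≤ ∑ j, (q j + q' j) :=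
        Finset.sum_le_sum fun j _ => abs_le.2 ⟨by linarith [hq.1 j, hq'.1 j],
          by linarith [hq.1 j, hq'.1 j]⟩
    _ = 2 := by rw [Finset.sum_add_distrib, hq.2, hq'.2]; norm_num

/-- If `Q` brings every law within `1/2` of `ν`, it contracts the zero-sum vectors by `1/2`. -/
theorem sum_abs_vecMul_le_half {Q : Matrix S S ℝ} {ν : S → ℝ}
    (hQ : ∀ q ∈ stdSimplex ℝ S, ∑ j, |(q ᵥ* Q) j - ν j| ≤ 1 / 2) {x : S → ℝ}
    (hx : ∑ i, x i = 0) : ∑ j, |(x ᵥ* Q) j| ≤ (∑ i, |x i|) / 2 := by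
  -- Zero sum gives the positive and negative parts of `x` the same mass `c`. Divided by `c`, both
  -- are laws, sent within `1/2` of `ν`; hence the image of `x` has norm at most `c`, half the norm
  -- of `x`.
  set c := ∑ i, max (x i) 0 with hc
  have hpm : ∀ i, x i = max (x i) 0 - max (-x i) 0 := fun i => by
    rcases le_total 0 (x i) with h | h <;> simp [h]
  have habs : ∀ i, |x i| = max (x i) 0 + max (-x i) 0 := fun i => by
    rcases le_total 0 (x i) with h | h <;> simp [h, abs_of_nonneg, abs_of_nonpos]
  have hc' : ∑ i, max (-x i) 0 = c := by
    have : ∑ i, x i = c - ∑ i, max (-x i) 0 := by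
      rw [hc, ← Finset.sum_sub_distrib]; exact Finset.sum_congr rfl fun i _ => hpm i
    linarith
  have hnorm : ∑ i, |x i| = 2 * c := by
    simp only [habs, Finset.sum_add_distrib]; rw [hc', ← hc]; ring
  have hc0 : 0 ≤ c := Finset.sum_nonneg fun i _ => le_max_right _ _
  rcases hc0.eq_or_lt with h0 | hpos
  · have hz : ∀ i, x i = 0 := fun i => by
      have := (Finset.sum_eq_zero_iff_of_nonneg (fun i _ => abs_nonneg (x i))).1
        (by rw [hnorm, ← h0]; ring) i (Finset.mem_univ i)
      exact abs_eq_zero.1 this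
    have : x = 0 := funext hz
    simp [this]
  · have hsimp : ∀ y : S → ℝ, (∑ i, max (y i) 0 = c) →
        (fun i => max (y i) 0 / c) ∈ stdSimplex ℝ S := fun y hy =>
      ⟨fun i => div_nonneg (le_max_right _ _) hc0, by
        rw [← Finset.sum_div, hy, div_self hpos.ne']⟩
    have h1 := hQ _ (hsimp x rfl)
    have h2 := hQ _ (hsimp (fun i => -x i) hc')
    have hx' : x = c • ((fun i => max (x i) 0 / c) - (fun i => max (-x i) 0 / c)) := by
      ext i
      simp only [Pi.smul_apply, Pi.sub_apply, smul_eq_mul]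
      rw [← sub_div, mul_div_cancel₀ _ hpos.ne']
      exact hpm i
    have hterm : ∀ j, |(x ᵥ* Q) j| ≤ c * (|((fun i => max (x i) 0 / c) ᵥ* Q) j - ν j| +
        |((fun i => max (-x i) 0 / c) ᵥ* Q) j - ν j|) := fun j => by
      conv_lhs => rw [hx', Matrix.smul_vecMul, Matrix.sub_vecMul]
      simp only [Pi.smul_apply, Pi.sub_apply, smul_eq_mul, abs_mul, abs_of_pos hpos]
      refine mul_le_mul_of_nonneg_left ?_ hc0
      have := abs_sub (((fun i => max (x i) 0 / c) ᵥ* Q) j - ν j)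
        (((fun i => max (-x i) 0 / c) ᵥ* Q) j - ν j)
      simpa using this
    calc ∑ j, |(x ᵥ* Q) j| ≤ _ := Finset.sum_le_sum fun j _ => hterm j
      _ ≤ (∑ i, |x i|) / 2 := by
        rw [← Finset.mul_sum, Finset.sum_add_distrib, hnorm]
        nlinarith

theorem stationary_vecMul_pow [DecidableEq S] {P : Matrix S S ℝ} {ν : S → ℝ} (hν : ν ᵥ* P = ν)
    (k : ℕ) : ν ᵥ* P ^ k = ν := by
  induction k with
  | zero => simp
  | succ k ih => rw [pow_succ, ← Matrix.vecMul_vecMul, ih, hν]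

/-- The difference `q - ν` has zero sum and norm at most 2. Each full block of `t` steps halves it,
and the remaining `k % t` steps do not increase it. -/
theorem sum_abs_vecMul_pow_sub_le [DecidableEq S] {P : Matrix S S ℝ}
    (hP : P ∈ Matrix.rowStochastic ℝ S) {ν : S → ℝ} (hνs : ν ∈ stdSimplex ℝ S)
    (hν : ν ᵥ* P = ν) {t : ℕ}
    (ht : ∀ q ∈ stdSimplex ℝ S, ∑ j, |(q ᵥ* P ^ t) j - ν j| ≤ 1 / 2)
    {q : S → ℝ} (hq : q ∈ stdSimplex ℝ S) (k : ℕ) :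
    ∑ j, |(q ᵥ* P ^ k) j - ν j| ≤ 2 * (1 / 2 : ℝ) ^ (k / t) := by
  have hrow : ∀ (Q : Matrix S S ℝ), Q ∈ Matrix.rowStochastic ℝ S → ∀ i, ∑ j, Q i j = 1 :=
    fun Q hQ => Matrix.sum_row_of_mem_rowStochastic hQ
  have key : ∀ n : ℕ, ∑ j, |((q - ν) ᵥ* P ^ (t * n)) j| ≤ 2 * (1 / 2 : ℝ) ^ n := by
    intro n
    induction n with
    | zero => simpa using sum_abs_sub_le_two hq hνs
    | succ n ih =>
      rw [mul_add, mul_one, pow_add, ← Matrix.vecMul_vecMul]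
      have hz : ∑ i, ((q - ν) ᵥ* P ^ (t * n)) i = 0 := by
        rw [sum_vecMul_of_row_sum (hrow _ (Submonoid.pow_mem _ hP _))]
        simp [Finset.sum_sub_distrib, hq.2, hνs.2]
      have := sum_abs_vecMul_le_half ht hz
      rw [pow_succ]
      linarith
  have hk : k = t * (k / t) + k % t := (Nat.div_add_mod k t).symm
  have hrw : ∀ j, (q ᵥ* P ^ k) j - ν j = (((q - ν) ᵥ* P ^ (t * (k / t))) ᵥ* P ^ (k % t)) j :=
    fun j => by
      rw [Matrix.vecMul_vecMul, ← pow_add, ← hk, Matrix.sub_vecMul, stationary_vecMul_pow hν]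
      rfl
  simp only [hrw]
  have hmem : P ^ (k % t) ∈ Matrix.rowStochastic ℝ S := Submonoid.pow_mem _ hP _
  exact (sum_abs_vecMul_le hmem.1 (hrow _ hmem) _).trans (key _)

/-- Each block of `t` consecutive terms is constant, and the blocks form a geometric series. This is
the source of the radius `4 tmix` of the search box. -/
theorem sum_half_pow_div_le {t : ℕ} (ht : 1 ≤ t) (T : ℕ) :
    ∑ k ∈ Finset.range T, 2 * (1 / 2 : ℝ) ^ (k / t) ≤ 4 * t := by
  have key : ∀ n : ℕ, ∑ k ∈ Finset.range (t * n), 2 * (1 / 2 : ℝ) ^ (k / t) =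
      4 * t * (1 - (1 / 2 : ℝ) ^ n) := by
    intro n
    induction n with
    | zero => simp
    | succ n ih =>
      rw [mul_add, mul_one, Finset.sum_range_add, ih]
      have : ∀ x ∈ Finset.range t, 2 * (1 / 2 : ℝ) ^ ((t * n + x) / t) = 2 * (1 / 2 : ℝ) ^ n := by
        intro x hx
        rw [Nat.mul_add_div (by omega), Nat.div_eq_of_lt (Finset.mem_range.1 hx), add_zero]
      rw [Finset.sum_congr rfl this, Finset.sum_const, Finset.card_range, nsmul_eq_mul, pow_succ]
      ring
  calc ∑ k ∈ Finset.range T, 2 * (1 / 2 : ℝ) ^ (k / t)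
      ≤ ∑ k ∈ Finset.range (t * T), 2 * (1 / 2 : ℝ) ^ (k / t) :=
        Finset.sum_le_sum_of_subset_of_nonneg
          (Finset.range_mono (Nat.le_mul_of_pos_left T (by omega)))
          (fun _ _ _ => by positivity)
    _ = 4 * t * (1 - (1 / 2 : ℝ) ^ T) := key T
    _ ≤ 4 * t := by
      have : (0 : ℝ) ≤ (1 / 2 : ℝ) ^ T := by positivity
      have : (0 : ℝ) ≤ 4 * t := by positivity
      nlinarith

theorem abs_dotProduct_sub_le {x ν r : S → ℝ} (hr : ∀ i, r i ∈ Set.Icc (0 : ℝ) 1) :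
    |x ⬝ᵥ r - ν ⬝ᵥ r| ≤ ∑ j, |x j - ν j| := by
  rw [← sub_dotProduct]
  refine (Finset.abs_sum_le_sum_abs _ _).trans (Finset.sum_le_sum fun j _ => ?_)
  rw [abs_mul, abs_of_nonneg (hr j).1]
  exact mul_le_of_le_one_right (abs_nonneg _) (hr j).2

theorem tendsto_dotProduct_vecMul_pow [DecidableEq S] {P : Matrix S S ℝ}
    (hP : P ∈ Matrix.rowStochastic ℝ S) {ν : S → ℝ} (hνs : ν ∈ stdSimplex ℝ S)
    (hν : ν ᵥ* P = ν) {t : ℕ} (ht1 : 1 ≤ t)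
    (ht : ∀ q ∈ stdSimplex ℝ S, ∑ j, |(q ᵥ* P ^ t) j - ν j| ≤ 1 / 2)
    {r : S → ℝ} (hr : ∀ i, r i ∈ Set.Icc (0 : ℝ) 1)
    {q : S → ℝ} (hq : q ∈ stdSimplex ℝ S) :
    Filter.Tendsto (fun k : ℕ => (q ᵥ* P ^ k) ⬝ᵥ r) Filter.atTop (𝓝 (ν ⬝ᵥ r)) := by
  rw [tendsto_iff_dist_tendsto_zero]
  have hlim : Filter.Tendsto (fun k : ℕ => 2 * (1 / 2 : ℝ) ^ (k / t)) Filter.atTop (𝓝 0) := by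
    have h1 : Filter.Tendsto (fun n : ℕ => 2 * (1 / 2 : ℝ) ^ n) Filter.atTop (𝓝 0) := by
      simpa using (tendsto_pow_atTop_nhds_zero_of_lt_one (r := (1 / 2 : ℝ))
        (by norm_num) (by norm_num)).const_mul 2
    exact h1.comp (Nat.tendsto_div_const_atTop (by omega))
  refine squeeze_zero (fun _ => dist_nonneg) (fun k => ?_) hlim
  rw [Real.dist_eq]
  exact (abs_dotProduct_sub_le hr).trans (sum_abs_vecMul_pow_sub_le hP hνs hν ht hq k)

/-- A solution of the Poisson equation of a mixing chain. -/
theorem exists_bias [DecidableEq S] {P : Matrix S S ℝ}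
    (hP : P ∈ Matrix.rowStochastic ℝ S) {ν : S → ℝ} (hνs : ν ∈ stdSimplex ℝ S)
    (hν : ν ᵥ* P = ν) {t : ℕ} (ht1 : 1 ≤ t)
    (ht : ∀ q ∈ stdSimplex ℝ S, ∑ j, |(q ᵥ* P ^ t) j - ν j| ≤ 1 / 2)
    {r : S → ℝ} (hr : ∀ i, r i ∈ Set.Icc (0 : ℝ) 1) :
    ∃ h : S → ℝ, (∀ i, |h i| ≤ 4 * t) ∧ ∀ i, ν ⬝ᵥ r + h i = r i + (P *ᵥ h) i := by
  set v := ν ⬝ᵥ r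
  -- The bias is the series of the terms `f i k`, absolutely convergent by geometric mixing.
  -- Splitting off its term at `k = 0` is the Poisson equation.
  set f : S → ℕ → ℝ := fun i k => (P ^ k *ᵥ r) i - v with hf
  have hfb : ∀ i k, |f i k| ≤ 2 * (1 / 2 : ℝ) ^ (k / t) := fun i k => by
    have h1 : (P ^ k *ᵥ r) i = (Pi.single i 1 ᵥ* P ^ k) ⬝ᵥ r := by
      rw [Matrix.single_one_vecMul]; rfl
    rw [hf]; simp only; rw [h1]
    exact (abs_dotProduct_sub_le hr).trans
      (sum_abs_vecMul_pow_sub_le hP hνs hν ht (single_mem_stdSimplex ℝ i) k)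
  have hsumabs : ∀ i T, ∑ k ∈ Finset.range T, |f i k| ≤ 4 * t := fun i T =>
    (Finset.sum_le_sum fun k _ => hfb i k).trans (sum_half_pow_div_le ht1 T)
  have hs' : ∀ i, Summable fun k => |f i k| := fun i =>
    summable_of_sum_range_le (fun _ => abs_nonneg _) (hsumabs i)
  have hs : ∀ i, Summable (f i) := fun i => (hs' i).of_abs
  refine ⟨fun i => ∑' k, f i k, fun i => ?_, fun i => ?_⟩
  · have h1 : ‖∑' k, f i k‖ ≤ ∑' k, ‖f i k‖ := norm_tsum_le_tsum_norm (hs' i)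
    exact h1.trans (Real.tsum_le_of_sum_range_le (fun _ => norm_nonneg _) (hsumabs i))
  · have hstep : ∀ k, f i (k + 1) = ∑ j, P i j * f j k := fun k => by
      simp only [hf, mul_sub, Finset.sum_sub_distrib, ← Finset.sum_mul,
        Matrix.sum_row_of_mem_rowStochastic hP, one_mul]
      rw [pow_succ', ← Matrix.mulVec_mulVec]
      rfl
    have h1 : (P *ᵥ fun i => ∑' k, f i k) i = ∑' k, f i (k + 1) := by
      simp only [hstep]
      rw [Summable.tsum_finsetSum fun j _ => (hs j).mul_left _]
      simp only [tsum_mul_left]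
      rfl
    rw [h1]
    beta_reduce
    rw [(hs i).tsum_eq_zero_add]
    simp only [hf, pow_zero, Matrix.one_mulVec]
    ring

end Stochastic

/-! ## Gain and bias of the policies of a mixing MDP -/

namespace AMDP

variable {S : Type} [Fintype S] [DecidableEq S] {A : S → Type} [∀ i, Fintype (A i)]

theorem trans_mem_rowStochastic (M : AMDP S A) {π : Pair A → ℝ} (hπ : IsPolicy π) :
    M.trans π ∈ Matrix.rowStochastic ℝ S := by
  rw [Matrix.mem_rowStochastic_iff_sum]
  refine ⟨fun i j => Finset.sum_nonneg fun a _ => mul_nonneg ((hπ i).1 a) ((M.P_mem _).1 j),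
    fun i => ?_⟩
  simp only [trans, Matrix.of_apply]
  rw [Finset.sum_comm]
  simp only [← Finset.mul_sum, (M.P_mem _).2, mul_one]
  exact (hπ i).2

omit [DecidableEq S] in
theorem reward_mem (M : AMDP S A) {π : Pair A → ℝ} (hπ : IsPolicy π) (i : S) :
    M.reward π i ∈ Set.Icc (0 : ℝ) 1 := by
  refine ⟨Finset.sum_nonneg fun a _ => mul_nonneg ((hπ i).1 a) (M.r_mem _).1, ?_⟩
  calc M.reward π i ≤ ∑ a, π ⟨i, a⟩ := Finset.sum_le_sum fun a _ =>
        mul_le_of_le_one_right ((hπ i).1 a) (M.r_mem _).2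
    _ = 1 := (hπ i).2

theorem Mixing.policyMixTime_spec {M : AMDP S A} (hM : M.Mixing) {π : Pair A → ℝ}
    (hπ : IsPolicy π) : 1 ≤ M.policyMixTime π ∧ M.MixedAt π (M.policyMixTime π) :=
  Nat.sInf_mem (s := {t | 1 ≤ t ∧ M.MixedAt π t}) (hM.1 π hπ)

theorem Mixing.policyMixTime_le {M : AMDP S A} (hM : M.Mixing) {π : Pair A → ℝ}
    (hπ : IsPolicy π) : M.policyMixTime π ≤ M.tmix :=
  le_csSup hM.2 ⟨π, hπ, rfl⟩

theorem Mixing.one_le_tmix {M : AMDP S A} (hM : M.Mixing) {π : Pair A → ℝ}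
    (hπ : IsPolicy π) : 1 ≤ M.tmix :=
  (hM.policyMixTime_spec hπ).1.trans (hM.policyMixTime_le hπ)

/-- Every policy of a mixing MDP has a stationary law `ν`, an average reward `v` and a bias `h`. -/
theorem Mixing.exists_gain_bias {M : AMDP S A} (hM : M.Mixing) {π : Pair A → ℝ}
    (hπ : IsPolicy π) : ∃ (ν : S → ℝ) (v : ℝ) (h : S → ℝ), ν ∈ stdSimplex ℝ S ∧
      ν ᵥ* M.trans π = ν ∧ v = ν ⬝ᵥ M.reward π ∧ v ∈ Set.Icc (0 : ℝ) 1 ∧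
      M.IsAverageReward π v ∧
      (∀ i, h i ∈ Set.Icc (-(4 * M.tmix : ℝ)) (4 * M.tmix)) ∧
      ∀ i, v + h i = M.reward π i + (M.trans π *ᵥ h) i := by
  obtain ⟨ht1, ν, hνs, hν, ht⟩ := hM.policyMixTime_spec hπ
  have hP := M.trans_mem_rowStochastic hπ
  have hr := M.reward_mem hπ
  obtain ⟨h, hb, hh⟩ := exists_bias hP hνs hν ht1 ht hr
  refine ⟨ν, _, h, hνs, hν, rfl, ⟨?_, ?_⟩, fun q hq => ?_, fun i => ?_, hh⟩
  · exact Finset.sum_nonneg fun i _ => mul_nonneg (hνs.1 i) (hr i).1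
  · calc ν ⬝ᵥ M.reward π ≤ ∑ i, ν i :=
          Finset.sum_le_sum fun i _ => mul_le_of_le_one_right (hνs.1 i) (hr i).2
      _ = 1 := hνs.2
  · have := (tendsto_dotProduct_vecMul_pow hP hνs hν ht1 ht hr hq).cesaro
    simpa [div_eq_inv_mul] using this
  · refine abs_le.1 ((hb i).trans ?_)
    have : (M.policyMixTime π : ℝ) ≤ M.tmix := by exact_mod_cast hM.policyMixTime_le hπ
    linarith

end AMDP

/-! ## One iteration of the parallel algorithm -/

section Steps

variable {S : Type} [Fintype S] [DecidableEq S] {A : S → Type} [∀ i, Fintype (A i)]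
  [∀ i, DecidableEq (A i)] {m : ℕ}

/-- The value of the constraint of the pair `a` at `(v, h)`, for the transition law `P`. -/
def violation (P : Pair A → S → ℝ) (r : Pair A → ℝ) (v : ℝ) (h : S → ℝ) (a : Pair A) : ℝ :=
  r a - v + ∑ j, P a j * h j - h a.1

/-- The pair at which the constraint values of the nodes are maximal. -/
def NetMem.top (sel : (Pair A → ℝ) → Pair A) (x : NetMem A) : Pair A :=
  sel fun a => (x.node a).c

/-- The iteration from the memory `x` is productive. -/
def NetMem.Productive (sel : (Pair A → ℝ) → Pair A) (thr : ℝ) (x : NetMem A) : Prop :=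
  (x.node (x.top sel)).c ≤ thr

theorem iteration_val_of_productive {η thr B : ℝ} {host : Pair A → Fin m}
    {sel : (Pair A → ℝ) → Pair A} {Pt : Pair A → S → ℝ} {smp : Pair A → S} {x : NetMem A}
    (hx : x.Productive sel thr) :
    (iteration η thr B host sel Pt smp x).val =
      { v := max 0 (min 1 (x.v - η)), h := x.h,
        node := fun b => { x.node b with
          c := (x.node b).c - (max 0 (min 1 (x.v - η)) - x.v), prod := (x.node b).prod + 1 } } := by
  have h : decide ((x.node (x.top sel)).c ≤ thr) = true := decide_eq_true hx
  change (if decide ((x.node (x.top sel)).c ≤ thr) = true then productiveStep η host x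
    else nonproductiveStep η B host Pt smp (x.top sel) x).val = _
  rw [if_pos h]
  rfl

/-- The vector `h` after a non-productive step. -/
def nonproductiveH (η B : ℝ) (h : S → ℝ) (i s : S) : S → ℝ :=
  let d := if s = i then 0 else η
  Function.update (Function.update h i (max (-B) (min B (h i + d)))) s (max (-B) (min B (h s - d)))

theorem iteration_val_of_not_productive {η thr B : ℝ} {host : Pair A → Fin m}
    {sel : (Pair A → ℝ) → Pair A} {Pt : Pair A → S → ℝ} {smp : Pair A → S} {x : NetMem A}
    (hx : ¬ x.Productive sel thr) :
    (iteration η thr B host sel Pt smp x).val =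
      let a := x.top sel
      let s := smp a
      let d := if s = a.1 then 0 else η
      let v' := max 0 (min 1 (x.v + η))
      { v := v', h := nonproductiveH η B x.h a.1 s,
        node := fun b => { x.node b with
          c := (x.node b).c - (v' - x.v)
            + (Pt b a.1 - if b.1 = a.1 then 1 else 0) *
              (max (-B) (min B (x.h a.1 + d)) - x.h a.1)
            + (Pt b s - if b.1 = s then 1 else 0) *
              (max (-B) (min B (x.h s - d)) - x.h s)
          cnt := (x.node b).cnt + if b = a then 1 else 0
          vis := (x.node b).vis + if b.1 = a.1 then 1 else 0 } } := by
  have h : ¬ decide ((x.node (x.top sel)).c ≤ thr) = true := by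
    rw [decide_eq_true_iff]; exact hx
  change (if decide ((x.node (x.top sel)).c ≤ thr) = true then productiveStep η host x
    else nonproductiveStep η B host Pt smp (x.top sel) x).val = _
  rw [if_neg h]
  -- The program branches on Booleans. With the conditions of the right-hand side put in that form,
  -- both sides agree by computation.
  have hd : ∀ (p : Prop) [Decidable p] (y z : ℝ),
      (if decide p = true then y else z) = if p then y else z := fun p _ y z => by
    by_cases hp : p <;> simp [hp]
  simp only [← hd (smp (x.top sel) = (x.top sel).1), ← hd (_ = (x.top sel).1),
    ← hd (_ = smp (x.top sel)), ← hd (_ = x.top sel), nonproductiveH]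
  rfl

theorem clip_sub_sq_le {lo hi x u : ℝ} (hu : u ∈ Set.Icc lo hi) :
    (max lo (min hi x) - u) ^ 2 ≤ (x - u) ^ 2 := by
  rcases le_total hi x with h | h
  · rw [min_eq_left h, max_eq_right (hu.1.trans hu.2)]
    nlinarith [hu.1, hu.2]
  · rw [min_eq_right h]
    rcases le_total lo x with h' | h'
    · rw [max_eq_right h']
    · rw [max_eq_left h']
      nlinarith [hu.1, hu.2]

theorem clip_mem {lo hi : ℝ} (h : lo ≤ hi) (x : ℝ) : max lo (min hi x) ∈ Set.Icc lo hi :=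
  ⟨le_max_left _ _, max_le h (min_le_left _ _)⟩

theorem clip_of_mem {lo hi x : ℝ} (h : x ∈ Set.Icc lo hi) : max lo (min hi x) = x := by
  rw [min_eq_right h.2, max_eq_right h.1]

omit [Fintype S] in
-- The two array writes amount to the Euclidean projection of the whole vector: untouched
-- coordinates already lie in the box, and for `s = i` the two increments cancel, as `d = 0`
-- encodes.
theorem nonproductiveH_eq (η B : ℝ) {h : S → ℝ} (hh : ∀ j, h j ∈ Set.Icc (-B) B) (i s : S) :
    nonproductiveH η B h i s = fun j =>
      max (-B) (min B (h j + η * ((if j = i then 1 else 0) - if j = s then 1 else 0))) := by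
  ext j
  simp only [nonproductiveH, Function.update_apply]
  by_cases hs : j = s
  · by_cases hi : j = i
    · have : s = i := hs ▸ hi
      simp [hs, this]
    · have : ¬ s = i := fun h => hi (hs.trans h)
      simp [hs, this, sub_eq_add_neg]
  · by_cases hi : j = i
    · have : ¬ s = i := fun h => hs (hi.trans h.symm)
      rw [if_neg hs, if_pos hi, if_neg this, if_pos hi, if_neg hs, hi]; simp
    · simp [hs, hi, clip_of_mem (hh j)]

/-- The squared Euclidean distance of the primal variables from `(u, w)`. -/
def NetMem.sqDist (x : NetMem A) (u : ℝ) (w : S → ℝ) : ℝ := (x.v - u) ^ 2 + ∑ j, (x.h j - w j) ^ 2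

/-- Equality holds for `i ≠ s`; for `i = s` the left side is unchanged and the last term is slack.
-/
theorem sum_sq_add_le (g : S → ℝ) (η : ℝ) (i s : S) :
    ∑ j, (g j + η * ((if j = i then 1 else 0) - if j = s then 1 else 0)) ^ 2 ≤
      ∑ j, g j ^ 2 + 2 * η * (g i - g s) + 2 * η ^ 2 := by
  have hexp : ∀ j, (g j + η * ((if j = i then 1 else 0) - if j = s then 1 else 0)) ^ 2 ≤
      g j ^ 2 + 2 * η * ((if j = i then g j else 0) - if j = s then g j else 0) +
        η ^ 2 * ((if j = i then 1 else 0) + if j = s then 1 else 0) := fun j => by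
    split_ifs <;> nlinarith [sq_nonneg η]
  refine (Finset.sum_le_sum fun j _ => hexp j).trans (le_of_eq ?_)
  simp only [Finset.sum_add_distrib, ← Finset.mul_sum, Finset.sum_sub_distrib,
    Finset.sum_ite_eq', Finset.mem_univ, if_true]
  ring

/-- What holds for the memory in every iteration. -/
structure NetMem.Valid (B : ℝ) (Pt : Pair A → S → ℝ) (r : Pair A → ℝ) (x : NetMem A) : Prop where
  v_mem : x.v ∈ Set.Icc (0 : ℝ) 1
  h_mem : ∀ j, x.h j ∈ Set.Icc (-B) B
  c_eq : ∀ b, (x.node b).c = violation Pt r x.v x.h b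
  cnt_nonneg : ∀ b, 0 ≤ (x.node b).cnt
  vis_eq : ∀ b, (x.node b).vis = ∑ a : A b.1, (x.node ⟨b.1, a⟩).cnt
  prod_nonneg : ∀ b, 0 ≤ (x.node b).prod

/-- A constraint value is affine in `(v, h)`, so correcting it by the actual, clipped changes of at
most three coordinates keeps it exact. -/
theorem NetMem.Valid.iteration {η thr B : ℝ} (hB : 0 ≤ B) {host : Pair A → Fin m}
    {sel : (Pair A → ℝ) → Pair A} {Pt : Pair A → S → ℝ} {r : Pair A → ℝ} {smp : Pair A → S}
    {x : NetMem A} (hx : x.Valid B Pt r) :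
    (iteration η thr B host sel Pt smp x).val.Valid B Pt r := by
  by_cases hp : x.Productive sel thr
  · rw [iteration_val_of_productive hp]
    refine ⟨clip_mem zero_le_one _, hx.h_mem, fun b => ?_, hx.cnt_nonneg, hx.vis_eq,
      fun b => add_nonneg (hx.prod_nonneg b) zero_le_one⟩
    simp only [hx.c_eq b, violation]
    ring
  · rw [iteration_val_of_not_productive hp]
    refine ⟨clip_mem zero_le_one _, fun j => ?_, fun b => ?_, fun b => ?_, fun b => ?_,
      hx.prod_nonneg⟩
    · simp only
      rw [nonproductiveH_eq η B hx.h_mem]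
      exact clip_mem (by linarith) _
    · simp only [hx.c_eq b, violation]
      generalize x.top sel = a
      generalize smp a = s
      set d := if s = a.1 then 0 else η with hd
      set hi' := max (-B) (min B (x.h a.1 + d)) with hi'def
      set hs' := max (-B) (min B (x.h s - d)) with hs'def
      have key : ∀ j, nonproductiveH η B x.h a.1 s j = x.h j +
          (if j = a.1 then hi' - x.h a.1 else 0) + (if j = s then hs' - x.h s else 0) := by
        intro j
        simp only [nonproductiveH, Function.update_apply, ← hd]
        by_cases hs : j = s
        · by_cases hi : j = a.1
          · have hsi : s = a.1 := hs ▸ hi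
            have hd0 : d = 0 := by rw [hd, if_pos hsi]
            have h1 : hi' = x.h a.1 := by
              rw [hi'def, hd0, add_zero]; exact clip_of_mem (hx.h_mem _)
            rw [if_pos hs, if_pos hi, if_pos hs, ← hs'def, h1, hs]
            ring
          · rw [if_pos hs, if_neg hi, if_pos hs, ← hs'def, hs]
            ring
        · by_cases hi : j = a.1
          · rw [if_neg hs, if_pos hi, if_pos hi, if_neg hs, ← hi'def, hi]
            ring
          · simp [hs, hi]
      simp only [key, mul_add, Finset.sum_add_distrib, mul_ite, mul_zero, Finset.sum_ite_eq',
        Finset.mem_univ, if_true]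
      have e1 : (if b.1 = a.1 then hi' - x.h a.1 else 0) =
          (if b.1 = a.1 then (1 : ℝ) else 0) * (hi' - x.h a.1) := by split_ifs <;> simp
      have e2 : (if b.1 = s then hs' - x.h s else 0) =
          (if b.1 = s then (1 : ℝ) else 0) * (hs' - x.h s) := by split_ifs <;> simp
      rw [e1, e2]
      ring
    · refine add_nonneg (hx.cnt_nonneg b) ?_
      split_ifs <;> simp
    · simp only [hx.vis_eq b, Finset.sum_add_distrib]
      congr 1
      generalize x.top sel = a
      obtain ⟨i, a⟩ := a
      obtain ⟨j, b⟩ := b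
      simp only
      by_cases h : j = i
      · subst h
        simp
      · have : ∀ c : A j, ¬ ((⟨j, c⟩ : Pair A) = ⟨i, a⟩) := fun c hc => h (congrArg Sigma.fst hc)
        simp [h, this]

theorem sqDist_iteration_of_productive {η thr B : ℝ} {host : Pair A → Fin m}
    {sel : (Pair A → ℝ) → Pair A} {Pt : Pair A → S → ℝ} {smp : Pair A → S} {x : NetMem A}
    (hp : x.Productive sel thr) {u : ℝ} (hu : u ∈ Set.Icc (0 : ℝ) 1) (w : S → ℝ) :
    (iteration η thr B host sel Pt smp x).val.sqDist u w ≤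
      x.sqDist u w - 2 * η * (x.v - u) + η ^ 2 := by
  rw [iteration_val_of_productive hp]
  simp only [NetMem.sqDist]
  have := clip_sub_sq_le (x := x.v - η) hu
  nlinarith

theorem sqDist_iteration_of_not_productive {η thr B : ℝ} {host : Pair A → Fin m}
    {sel : (Pair A → ℝ) → Pair A} {Pt : Pair A → S → ℝ} {smp : Pair A → S} {x : NetMem A}
    (hp : ¬ x.Productive sel thr) (hh : ∀ j, x.h j ∈ Set.Icc (-B) B) {u : ℝ}
    (hu : u ∈ Set.Icc (0 : ℝ) 1) {w : S → ℝ} (hw : ∀ j, w j ∈ Set.Icc (-B) B) :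
    (iteration η thr B host sel Pt smp x).val.sqDist u w ≤
      x.sqDist u w + 2 * η * (x.v - u) + 2 * η * ((x.h (x.top sel).1 - w (x.top sel).1) -
        (x.h (smp (x.top sel)) - w (smp (x.top sel)))) + 3 * η ^ 2 := by
  rw [iteration_val_of_not_productive hp]
  simp only [NetMem.sqDist]
  generalize x.top sel = a
  generalize smp a = s
  rw [nonproductiveH_eq η B hh]
  have h1 := clip_sub_sq_le (x := x.v + η) hu
  have h2 : ∑ j, (max (-B) (min B (x.h j + η * ((if j = a.1 then 1 else 0) -
      if j = s then 1 else 0))) - w j) ^ 2 ≤ ∑ j, ((x.h j - w j) +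
        η * ((if j = a.1 then 1 else 0) - if j = s then 1 else 0)) ^ 2 :=
    Finset.sum_le_sum fun j _ => (clip_sub_sq_le (hw j)).trans (le_of_eq (by ring))
  have h3 := sum_sq_add_le (fun j => x.h j - w j) η a.1 s
  nlinarith

end Steps

/-! ## Optimality of the output for good samples -/

section Regret

variable {S : Type} [Fintype S] [DecidableEq S] {A : S → Type} [∀ i, Fintype (A i)]
  [∀ i, DecidableEq (A i)] {m : ℕ}

/-- The deviation of `y` at the sample `s` from its mean under the law `p`. -/
def deviation (p : S → ℝ) (y : S → ℝ) (s : S) : ℝ := y s - ∑ j, p j * y j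

omit [DecidableEq S] [(i : S) → Fintype (A i)] [(i : S) → DecidableEq (A i)] in
-- The inner product of the stochastic step direction with the displacement from the comparator
-- splits into a mean-zero noise and a difference of two constraint values.
theorem violation_sub_violation (P : Pair A → S → ℝ) (r : Pair A → ℝ) (v u : ℝ) (h w : S → ℝ)
    (a : Pair A) (s : S) :
    (h s - w s) - (h a.1 - w a.1) - (v - u) = deviation (P a) (fun j => h j - w j) s +
      violation P r v h a - violation P r u w a := by
  simp only [deviation, violation, mul_sub, Finset.sum_sub_distrib]
  ring

open Classical in
/-- The function whose deviation at the sample is the noise of one iteration, for the comparator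
`w`: it vanishes in productive steps. -/
noncomputable def NetMem.noiseFun (sel : (Pair A → ℝ) → Pair A) (thr : ℝ) (x : NetMem A) (w : S → ℝ) : S → ℝ :=
  if x.Productive sel thr then 0 else fun j => x.h j - w j

/-- The total number of non-productive steps. -/
def NetMem.total (x : NetMem A) : ℝ := ∑ b, (x.node b).cnt

theorem sum_cnt_mul_iteration_of_productive {η thr B : ℝ} {host : Pair A → Fin m}
    {sel : (Pair A → ℝ) → Pair A} {Pt : Pair A → S → ℝ} {smp : Pair A → S} {x : NetMem A}
    (hp : x.Productive sel thr) (f : Pair A → ℝ) :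
    ∑ b, ((iteration η thr B host sel Pt smp x).val.node b).cnt * f b =
      ∑ b, (x.node b).cnt * f b := by
  rw [iteration_val_of_productive hp]

theorem sum_cnt_mul_iteration_of_not_productive {η thr B : ℝ} {host : Pair A → Fin m}
    {sel : (Pair A → ℝ) → Pair A} {Pt : Pair A → S → ℝ} {smp : Pair A → S} {x : NetMem A}
    (hp : ¬ x.Productive sel thr) (f : Pair A → ℝ) :
    ∑ b, ((iteration η thr B host sel Pt smp x).val.node b).cnt * f b =
      ∑ b, (x.node b).cnt * f b + f (x.top sel) := by
  rw [iteration_val_of_not_productive hp]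
  simp only [add_mul, Finset.sum_add_distrib, ite_mul, one_mul, zero_mul, Finset.sum_ite_eq',
    Finset.mem_univ, if_true]

omit [DecidableEq S] [(i : S) → Fintype (A i)] [(i : S) → DecidableEq (A i)] in
theorem violation_sub_violation_law (P Pt : Pair A → S → ℝ) (r : Pair A → ℝ) (v : ℝ) (h : S → ℝ)
    (a : Pair A) :
    violation Pt r v h a - violation P r v h a = ∑ j, (Pt a j - P a j) * h j := by
  simp only [violation, sub_mul, Finset.sum_sub_distrib]
  ring

variable {η δ B : ℝ} {host : Pair A → Fin m} {sel : (Pair A → ℝ) → Pair A} {r : Pair A → ℝ}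
  {P Pt : Pair A → S → ℝ} {n : ℕ} {Y : Pair A × ℕ → S}

theorem iterates_valid {thr : ℝ} (hB : 0 ≤ B) (k : ℕ) :
    (iterates η thr B host sel r Pt n Y k).val.Valid B Pt r := by
  induction k with
  | zero =>
    refine ⟨⟨le_rfl, zero_le_one⟩, fun j => ⟨by change -B ≤ 0; linarith, hB⟩, fun b => ?_,
      fun b => le_rfl, fun b => ?_, fun b => le_rfl⟩
    · change r b = r b - 0 + ∑ j, Pt b j * 0 - 0
      simp
    · change (0 : ℝ) = ∑ a : A b.1, 0
      simp
  | succ k ih => exact ih.iteration hB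

/-- The numbers of productive and non-productive steps add up. -/
theorem iterates_prod_add_total {thr : ℝ} (k : ℕ) (b : Pair A) :
    ((iterates η thr B host sel r Pt n Y k).val.node b).prod +
      (iterates η thr B host sel r Pt n Y k).val.total = k := by
  induction k with
  | zero =>
    change (0 : ℝ) + ∑ b : Pair A, 0 = ((0 : ℕ) : ℝ)
    simp
  | succ k ih =>
    simp only [iterates]
    set x := (iterates η thr B host sel r Pt n Y k).val
    by_cases hp : x.Productive sel thr
    · have h1 := sum_cnt_mul_iteration_of_productive (η := η) (B := B) (host := host) (Pt := Pt)
        (smp := fun a => Y (a, n + k)) hp (fun _ => 1)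
      simp only [mul_one] at h1
      have h2 : ((iteration η thr B host sel Pt (fun a => Y (a, n + k)) x).val.node b).prod =
          (x.node b).prod + 1 := by rw [iteration_val_of_productive hp]
      rw [h2, NetMem.total, h1]
      push_cast
      rw [← ih, NetMem.total]
      ring
    · have h1 := sum_cnt_mul_iteration_of_not_productive (η := η) (B := B) (host := host) (Pt := Pt)
        (smp := fun a => Y (a, n + k)) hp (fun _ => 1)
      simp only [mul_one] at h1
      have h2 : ((iteration η thr B host sel Pt (fun a => Y (a, n + k)) x).val.node b).prod =
          (x.node b).prod := by rw [iteration_val_of_not_productive hp]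
      rw [h2, NetMem.total, h1]
      push_cast
      rw [← ih, NetMem.total]
      ring

/-- The noise of the first `N` iterations for the comparator `w`. -/
noncomputable def noise (P : Pair A → S → ℝ) (sel : (Pair A → ℝ) → Pair A) (thr : ℝ) (Y : Pair A × ℕ → S) (n : ℕ)
    (x : ℕ → NetMem A) (w : S → ℝ) (N : ℕ) : ℝ :=
  ∑ l ∈ Finset.range N, deviation (P ((x l).top sel)) ((x l).noiseFun sel thr w)
    (Y ((x l).top sel, n + l))

/-- The regret bound of mirror descent with constraints. -/
theorem regret_bound (hη : 0 ≤ η) (hB : 0 ≤ B)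
    (hsel : ∀ (g : Pair A → ℝ) (a : Pair A), g a ≤ g (sel g))
    (hPt : ∀ a (h : S → ℝ), (∀ j, h j ∈ Set.Icc (-B) B) → |∑ j, (Pt a j - P a j) * h j| ≤ δ)
    {vlow : ℝ} (hlow : ∀ v h, (∀ a, violation P r v h a ≤ 3 * δ) → vlow ≤ v)
    {u : ℝ} (hu : u ∈ Set.Icc (0 : ℝ) 1) {w : S → ℝ} (hw : ∀ j, w j ∈ Set.Icc (-B) B) (k : ℕ) :
    let x := fun l => (iterates η (δ + δ) B host sel r Pt n Y l).val
    (x k).sqDist u w + 2 * η * ((k - (x k).total) * (vlow - u) + δ * (x k).total -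
      ∑ b, ((x k).node b).cnt * violation P r u w b + noise P sel (δ + δ) Y n x w k) ≤
      (u ^ 2 + ∑ j, w j ^ 2) + 3 * η ^ 2 * k := by
  intro x
  induction k with
  | zero =>
    have h1 : (x 0).total = 0 := by change ∑ b : Pair A, (0 : ℝ) = 0; simp
    have h2 : ∑ b, ((x 0).node b).cnt * violation P r u w b = 0 := by
      change ∑ b, (0 : ℝ) * violation P r u w b = 0; simp
    have h3 : (x 0).sqDist u w = u ^ 2 + ∑ j, w j ^ 2 := by
      change (0 - u) ^ 2 + ∑ j, (0 - w j) ^ 2 = _; simp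
    rw [h1, h2, h3]
    simp [noise]
  | succ k ih =>
    have hx1 : x (k + 1) =
        (iteration η (δ + δ) B host sel Pt (fun a => Y (a, n + k)) (x k)).val := rfl
    have hval : (x k).Valid B Pt r := iterates_valid hB k
    have hnoise : noise P sel (δ + δ) Y n x w (k + 1) = noise P sel (δ + δ) Y n x w k +
        deviation (P ((x k).top sel)) ((x k).noiseFun sel (δ + δ) w)
          (Y ((x k).top sel, n + k)) := Finset.sum_range_succ _ _
    have hgap : ∀ a, |violation Pt r (x k).v (x k).h a - violation P r (x k).v (x k).h a| ≤ δ :=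
      fun a => by rw [violation_sub_violation_law]; exact hPt a _ hval.h_mem
    rw [hnoise]
    by_cases hp : (x k).Productive sel (δ + δ)
    · have hd := sqDist_iteration_of_productive (η := η) (B := B) (host := host) (Pt := Pt)
        (smp := fun a => Y (a, n + k)) hp hu w
      have hc := sum_cnt_mul_iteration_of_productive (η := η) (B := B) (host := host) (Pt := Pt)
        (smp := fun a => Y (a, n + k)) hp
      have ht : (x (k + 1)).total = (x k).total := by
        have := hc fun _ => 1
        simp only [mul_one] at this
        exact this
      rw [← hx1] at hd hc
      -- The maximal estimated value is at most `2δ` and the estimation error at most `δ`, so every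
      -- true value is at most `3δ`.
      have hv : vlow ≤ (x k).v := hlow _ (x k).h fun a => by
        have h1 : ((x k).node a).c ≤ δ + δ := (hsel (fun a => ((x k).node a).c) a).trans hp
        rw [hval.c_eq] at h1
        linarith [(abs_le.1 (hgap a)).1]
      have hz : deviation (P ((x k).top sel)) ((x k).noiseFun sel (δ + δ) w)
          (Y ((x k).top sel, n + k)) = 0 := by
        simp [NetMem.noiseFun, hp, deviation]
      rw [hz, hc, ht]
      push_cast
      nlinarith [mul_le_mul_of_nonneg_left hv hη, sq_nonneg η]
    · have hd := sqDist_iteration_of_not_productive (η := η) (B := B) (host := host) (Pt := Pt)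
        (smp := fun a => Y (a, n + k)) hp hval.h_mem hu hw
      have hc := sum_cnt_mul_iteration_of_not_productive (η := η) (B := B) (host := host) (Pt := Pt)
        (smp := fun a => Y (a, n + k)) hp
      have ht : (x (k + 1)).total = (x k).total + 1 := by
        have := hc fun _ => 1
        simp only [mul_one] at this
        exact this
      rw [← hx1] at hd hc
      -- Here the estimated value exceeds `2δ`, so the true one exceeds `δ`. This is the term `δ`
      -- earned per non-productive step.
      have hviol : δ ≤ violation P r (x k).v (x k).h ((x k).top sel) := by
        have h1 : δ + δ < ((x k).node ((x k).top sel)).c := not_le.1 hp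
        rw [hval.c_eq] at h1
        linarith [(abs_le.1 (hgap ((x k).top sel))).2]
      have hz : (x k).noiseFun sel (δ + δ) w = fun j => (x k).h j - w j := by
        simp [NetMem.noiseFun, hp]
      have hid := violation_sub_violation P r (x k).v u (x k).h w ((x k).top sel)
        (Y ((x k).top sel, n + k))
      rw [hz, hc, ht]
      push_cast
      have h2 := mul_le_mul_of_nonneg_left hviol hη
      set a := (x k).top sel
      set s := Y (a, n + k)
      set D := deviation (P a) (fun j => (x k).h j - w j) s
      have h3 : 2 * η * ((x k).v - u) + 2 * η * ((x k).h a.1 - w a.1 - ((x k).h s - w s)) =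
          - (2 * η * (D + violation P r (x k).v (x k).h a - violation P r u w a)) := by
        rw [← hid]; ring
      nlinarith

end Regret

/-! ### From the regret bound to the optimality of the output policy -/

section Output

variable {S : Type} [Fintype S] [DecidableEq S] {A : S → Type} [∀ i, Fintype (A i)]
  [∀ i, DecidableEq (A i)] {m : ℕ}

omit [DecidableEq S] [(i : S) → DecidableEq (A i)] in
theorem sum_policy_mul_violation (M : AMDP S A) {π : Pair A → ℝ} (hπ : IsPolicy π) (v : ℝ)
    (h : S → ℝ) (i : S) : ∑ a : A i, π ⟨i, a⟩ * violation M.P M.r v h ⟨i, a⟩ =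
      M.reward π i - v + (M.trans π *ᵥ h) i - h i := by
  have h1 : ∑ a : A i, π ⟨i, a⟩ = 1 := (hπ i).2
  have h2 : (M.trans π *ᵥ h) i = ∑ a : A i, π ⟨i, a⟩ * ∑ j, M.P ⟨i, a⟩ j * h j := by
    simp only [Matrix.mulVec, dotProduct, AMDP.trans, Matrix.of_apply, Finset.sum_mul,
      Finset.mul_sum, mul_assoc]
    rw [Finset.sum_comm]
  rw [h2]
  simp only [violation, mul_sub, mul_add, Finset.sum_sub_distrib, Finset.sum_add_distrib,
    ← Finset.sum_mul, h1, AMDP.reward, one_mul]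

omit [DecidableEq S] [(i : S) → DecidableEq (A i)] in
-- Weak duality: averaging the constraints over the policy and its stationary law cancels `h`.
theorem stationary_reward_le (M : AMDP S A) {π : Pair A → ℝ} (hπ : IsPolicy π) {ν : S → ℝ}
    (hνs : ν ∈ stdSimplex ℝ S) (hν : ν ᵥ* M.trans π = ν) {v δ : ℝ} {h : S → ℝ}
    (hv : ∀ a, violation M.P M.r v h a ≤ δ) : ν ⬝ᵥ M.reward π ≤ v + δ := by
  have h1 : ∀ i, M.reward π i - v + (M.trans π *ᵥ h) i - h i ≤ δ := fun i => by
    rw [← sum_policy_mul_violation M hπ]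
    calc ∑ a : A i, π ⟨i, a⟩ * violation M.P M.r v h ⟨i, a⟩ ≤ ∑ a : A i, π ⟨i, a⟩ * δ :=
          Finset.sum_le_sum fun a _ => mul_le_mul_of_nonneg_left (hv _) ((hπ i).1 a)
      _ = δ := by
        rw [← Finset.sum_mul, (hπ i).2, one_mul]
  have h2 : ν ⬝ᵥ (fun i => M.reward π i - v + (M.trans π *ᵥ h) i - h i) ≤ ν ⬝ᵥ (fun _ => δ) :=
    Finset.sum_le_sum fun i _ => mul_le_mul_of_nonneg_left (h1 i) (hνs.1 i)
  have h3 : ν ⬝ᵥ (M.trans π *ᵥ h) = ν ⬝ᵥ h := by rw [Matrix.dotProduct_mulVec, hν]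
  have hc : ∀ c : ℝ, ∑ i, ν i * c = c := fun c => by rw [← Finset.sum_mul, hνs.2, one_mul]
  simp only [dotProduct, mul_sub, mul_add, Finset.sum_sub_distrib, Finset.sum_add_distrib,
    hc] at h2 h3 ⊢
  linarith

/-- The policy with weights `cnt` and marginal weights `vis`. -/
noncomputable def normalizedPolicy (π₀ cnt vis : Pair A → ℝ) (a : Pair A) : ℝ :=
  if vis a = 0 then π₀ a else cnt a / vis a

omit [Fintype S] [DecidableEq S] [(i : S) → DecidableEq (A i)] in
theorem normalizedPolicy_isPolicy {π₀ cnt vis : Pair A → ℝ} (h₀ : IsPolicy π₀)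
    (hcnt : ∀ a, 0 ≤ cnt a) (hvis : ∀ b, vis b = ∑ a : A b.1, cnt ⟨b.1, a⟩) :
    IsPolicy (normalizedPolicy π₀ cnt vis) := fun i => by
  by_cases h : ∑ a : A i, cnt ⟨i, a⟩ = 0
  · have : (fun a : A i => normalizedPolicy π₀ cnt vis ⟨i, a⟩) = fun a => π₀ ⟨i, a⟩ := by
      ext a
      simp [normalizedPolicy, hvis, h]
    rw [this]; exact h₀ i
  · have : (fun a : A i => normalizedPolicy π₀ cnt vis ⟨i, a⟩) =
        fun a => cnt ⟨i, a⟩ / ∑ a : A i, cnt ⟨i, a⟩ := by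
      ext a
      simp [normalizedPolicy, hvis, h]
    rw [this]
    exact ⟨fun a => div_nonneg (hcnt _) (Finset.sum_nonneg fun a _ => hcnt _), by
      rw [← Finset.sum_div, div_self h]⟩

omit [Fintype S] [DecidableEq S] [(i : S) → DecidableEq (A i)] in
-- At a state with zero total all counts vanish, being nonnegative, so the default policy does no
-- harm.
theorem normalizedPolicy_mul {π₀ cnt vis : Pair A → ℝ}
    (hcnt : ∀ a, 0 ≤ cnt a) (hvis : ∀ b, vis b = ∑ a : A b.1, cnt ⟨b.1, a⟩) (a : Pair A) :
    cnt a = vis a * normalizedPolicy π₀ cnt vis a := by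
  by_cases h : vis a = 0
  · rw [h, zero_mul]
    rw [hvis a] at h
    exact (Finset.sum_eq_zero_iff_of_nonneg (fun b _ => hcnt _)).1 h a.2 (Finset.mem_univ _)
  · rw [normalizedPolicy, if_neg h, mul_div_cancel₀ _ h]

omit [DecidableEq S] [(i : S) → DecidableEq (A i)] in
-- At each state the counts are a multiple of the policy's probabilities, and the policy average of
-- the constraint values is the defect of its Poisson equation, which is zero.
theorem sum_cnt_mul_violation_eq_zero (M : AMDP S A) {π₀ cnt vis : Pair A → ℝ} (h₀ : IsPolicy π₀)
    (hcnt : ∀ a, 0 ≤ cnt a) (hvis : ∀ b, vis b = ∑ a : A b.1, cnt ⟨b.1, a⟩) {v : ℝ} {h : S → ℝ}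
    (hh : ∀ i, v + h i = M.reward (normalizedPolicy π₀ cnt vis) i +
      (M.trans (normalizedPolicy π₀ cnt vis) *ᵥ h) i) :
    ∑ a, cnt a * violation M.P M.r v h a = 0 := by
  set π := normalizedPolicy π₀ cnt vis with hπdef
  have hπ : IsPolicy π := normalizedPolicy_isPolicy h₀ hcnt hvis
  rw [Fintype.sum_sigma]
  refine Finset.sum_eq_zero fun i _ => ?_
  have h1 : ∀ a : A i, cnt ⟨i, a⟩ * violation M.P M.r v h ⟨i, a⟩ =
      (∑ a : A i, cnt ⟨i, a⟩) * (π ⟨i, a⟩ * violation M.P M.r v h ⟨i, a⟩) := fun a => by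
    rw [← mul_assoc, normalizedPolicy_mul (π₀ := π₀) hcnt hvis, hvis ⟨i, a⟩]
  rw [Finset.sum_congr rfl fun a _ => h1 a, ← Finset.mul_sum, sum_policy_mul_violation M hπ]
  have := hh i
  rw [show M.reward π i - v + (M.trans π *ᵥ h) i - h i = 0 by linarith, mul_zero]

omit [DecidableEq S] [(i : S) → DecidableEq (A i)] in
-- The common divisor `prod` cancels. Were it zero, the convention `y / 0 = 0` would yield the
-- default policy everywhere.
theorem extractPolicy_val {host : Pair A → Fin m} {π₀ : Pair A → ℝ} {x : NetMem A}
    (hx : ∀ b, (x.node b).prod ≠ 0) : (extractPolicy host π₀ x).val =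
      normalizedPolicy π₀ (fun b => (x.node b).cnt) (fun b => (x.node b).vis) := by
  ext a
  change (if decide ((x.node a).vis / (x.node a).prod = 0) = true then Timed.load π₀ a
    else Timed.div ((x.node a).cnt / (x.node a).prod) ((x.node a).vis / (x.node a).prod)).val = _
  by_cases h : (x.node a).vis = 0
  · simp [normalizedPolicy, h, Timed.load, Timed.tick]
  · have : ¬ (x.node a).vis / (x.node a).prod = 0 := div_ne_zero h (hx a)
    simp only [this, decide_false, Bool.false_eq_true, if_false, normalizedPolicy, h, Timed.div,
      Timed.tick]
    rw [div_div_div_cancel_right₀ (hx a)]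

/-- The output is `ε`-optimal if the estimate of the transition law is accurate and the noise is
small. -/
theorem isEpsOptimal_parallelAMDP {M : AMDP S A} (hM : M.Mixing)
    {sel : (Pair A → ℝ) → Pair A} (hsel : ∀ (g : Pair A → ℝ) (a : Pair A), g a ≤ g (sel g))
    {π₀ : Pair A → ℝ} (h₀ : IsPolicy π₀) {host : Pair A → Fin m} {ε : ℝ} (hε : 0 < ε)
    {n N : ℕ} {Y : Pair A × ℕ → S} [Nonempty S]
    (hP : ∀ a (h : S → ℝ), (∀ j, h j ∈ Set.Icc (-(4 * M.tmix : ℝ)) (4 * M.tmix)) →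
      |∑ j, (empirical n Y a j - M.P a j) * h j| ≤ ε / 16)
    (hnoise : ∀ w, (∀ j, w j ∈ Set.Icc (-(4 * M.tmix : ℝ)) (4 * M.tmix)) →
      -(ε / 128 * N) ≤ noise M.P sel (ε / 16 + ε / 16) Y n (fun l =>
        (iterates (ε / 64) (ε / 16 + ε / 16) (4 * M.tmix) host sel M.r (empirical n Y) n Y l).val)
        w N)
    (hN : 69632 * ((M.tmix : ℝ) ^ 2 * Fintype.card S / ε ^ 2) ≤ N) :
    M.IsEpsOptimal ε (parallelAMDP M ε n N host sel π₀ Y).val := by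
  have ht1 : (1 : ℝ) ≤ M.tmix := by exact_mod_cast hM.one_le_tmix h₀
  have hS1 : (1 : ℝ) ≤ Fintype.card S := by exact_mod_cast Fintype.card_pos
  have hB : (0 : ℝ) ≤ 4 * M.tmix := by linarith
  have htS : (1 : ℝ) ≤ (M.tmix : ℝ) ^ 2 * Fintype.card S := by nlinarith
  have hN' : 69632 * ((M.tmix : ℝ) ^ 2 * Fintype.card S) ≤ N * ε ^ 2 := by
    rw [← mul_div_assoc, div_le_iff₀ (by positivity)] at hN
    exact hN
  have hNpos : (0 : ℝ) < N := by
    by_contra hcon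
    have : (N : ℝ) * ε ^ 2 ≤ 0 := mul_nonpos_of_nonpos_of_nonneg (not_lt.1 hcon) (sq_nonneg _)
    linarith
  set x := fun l =>
    (iterates (ε / 64) (ε / 16 + ε / 16) (4 * M.tmix) host sel M.r (empirical n Y) n Y l).val with hx
  have hval : (x N).Valid (4 * M.tmix) (empirical n Y) M.r := iterates_valid hB N
  set π := normalizedPolicy π₀ (fun b => ((x N).node b).cnt) (fun b => ((x N).node b).vis) with hπdef
  have hπ : IsPolicy π := normalizedPolicy_isPolicy h₀ hval.cnt_nonneg hval.vis_eq
  obtain ⟨ν, v, h, -, -, -, hv01, havg, hbox, hpoisson⟩ := hM.exists_gain_bias hπ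
  have hzero := sum_cnt_mul_violation_eq_zero M h₀ hval.cnt_nonneg hval.vis_eq hpoisson
  -- The constant is `17 = 1 + 4 ^ 2`, from the gain and the bias.
  have hsq : v ^ 2 + ∑ j, h j ^ 2 ≤ 17 * ((M.tmix : ℝ) ^ 2 * Fintype.card S) := by
    have h1 : v ^ 2 ≤ 1 := by nlinarith [hv01.1, hv01.2]
    have h2 : ∑ j, h j ^ 2 ≤ ∑ _j : S, (4 * M.tmix : ℝ) ^ 2 :=
      Finset.sum_le_sum fun j _ => sq_le_sq' (hbox j).1 (hbox j).2
    rw [Finset.sum_const, Finset.card_univ, nsmul_eq_mul] at h2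
    nlinarith
  have htot : 0 ≤ (x N).total := Finset.sum_nonneg fun b _ => hval.cnt_nonneg b
  have main : ∀ vlow, (∀ v h, (∀ a, violation M.P M.r v h a ≤ 3 * (ε / 16)) → vlow ≤ v) →
      (N - (x N).total) * (vlow - v) + ε / 16 * (x N).total ≤ 5 / 128 * ε * N := by
    intro vlow hlow
    have hreg := regret_bound (η := ε / 64) (host := host) (Y := Y) (n := n) (by positivity) hB hsel
      hP hlow hv01 hbox N
    simp only at hreg
    have hno := hnoise h hbox
    have hd0 : 0 ≤ (x N).sqDist v h :=
      add_nonneg (sq_nonneg _) (Finset.sum_nonneg fun j _ => sq_nonneg _)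
    rw [hzero] at hreg
    set Z := (N - (x N).total) * (vlow - v) + ε / 16 * (x N).total with hZ
    have h1 : 2 * (ε / 64) * (Z - ε / 128 * N) ≤
        17 * ((M.tmix : ℝ) ^ 2 * Fintype.card S) + 3 * (ε / 64) ^ 2 * N := by
      have : 2 * (ε / 64) * (Z - ε / 128 * N) ≤ 2 * (ε / 64) * (Z - 0 +
          noise M.P sel (ε / 16 + ε / 16) Y n x h N) :=
        mul_le_mul_of_nonneg_left (by linarith) (by positivity)
      linarith
    -- Since `69632 = 17 * 4096`. After division by `2η = ε / 32`, the initial distance, the noise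
    -- and the squared steps contribute 1, 1 and 3 times `ε N / 128`.
    have h2 : 17 * ((M.tmix : ℝ) ^ 2 * Fintype.card S) ≤ ε ^ 2 / 4096 * N := by linarith
    have h3 : ε * Z ≤ ε * (5 / 128 * ε * N) := by nlinarith
    exact le_of_mul_le_mul_left h3 hε
  obtain ⟨s₀⟩ := ‹Nonempty S›
  have hne : ∀ b, ((x N).node b).prod = N - (x N).total := fun b => by
    have := iterates_prod_add_total (η := ε / 64) (thr := ε / 16 + ε / 16) (B := 4 * M.tmix)
      (host := host) (sel := sel) (r := M.r) (Pt := empirical n Y) (n := n) (Y := Y) N b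
    exact eq_sub_of_add_eq this
  have hgain : ∀ π', IsPolicy π' → ∃ v', M.IsAverageReward π' v' ∧
      (N - (x N).total) * (v' - 3 * (ε / 16) - v) + ε / 16 * (x N).total ≤ 5 / 128 * ε * N := by
    intro π' hπ'
    obtain ⟨ν', v', -, hνs', hν', hv', -, havg', -, -⟩ := hM.exists_gain_bias hπ'
    refine ⟨v', havg', main _ fun v₁ h₁ hviol => ?_⟩
    have := stationary_reward_le M hπ' hνs' hν' hviol
    rw [← hv'] at this
    linarith
  have hprod0 : 0 ≤ N - (x N).total := by
    rw [← hne (sel fun _ => 0)]; exact hval.prod_nonneg _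
  -- Without productive steps the bound would read `(ε / 16) N ≤ (5 / 128) ε N`.
  have hprod : 0 < N - (x N).total := by
    refine hprod0.lt_of_ne fun h0 => ?_
    obtain ⟨v', -, hv'⟩ := hgain π₀ h₀
    rw [← h0, zero_mul, zero_add, show (x N).total = N by linarith] at hv'
    nlinarith
  have hout : (parallelAMDP M ε n N host sel π₀ Y).val = π :=
    extractPolicy_val (host := host) (x := x N) fun b => by rw [hne b]; exact hprod.ne'
  rw [hout]
  refine ⟨hπ, v, havg, fun π' hπ' => ?_⟩
  obtain ⟨v', havg', hv'⟩ := hgain π' hπ'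
  refine ⟨v', havg', ?_⟩
  have h1 : (N - (x N).total) * (v' - 3 * (ε / 16) - v) ≤ (N - (x N).total) * (5 / 128 * ε) := by
    nlinarith
  have := le_of_mul_le_mul_left h1 hprod
  linarith

end Output

/-! ## Concentration for adaptively chosen samples -/

section Concentration

open MeasureTheory ProbabilityTheory

variable {S : Type} [Fintype S] [DecidableEq S] {A : S → Type} [∀ i, Fintype (A i)]
  [MeasurableSpace S] [MeasurableSingletonClass S]
  {Ω : Type*} [MeasurableSpace Ω] {μ : Measure Ω} [IsProbabilityMeasure μ]
  {M : AMDP S A} {X : Pair A × ℕ → Ω → S}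

omit [DecidableEq S] [(i : S) → Fintype (A i)] in
theorem AMDP.IsSampler.integral_comp (hX : M.IsSampler μ X) (p : Pair A) (l : ℕ) (f : S → ℝ) :
    ∫ ω, f (X (p, l) ω) ∂μ = ∑ s, M.P p s * f s := by
  have hm := hX.1 (p, l)
  rw [← integral_map (φ := X (p, l)) (f := f) hm.aemeasurable
    (Measurable.of_discrete.aestronglyMeasurable)]
  have : IsProbabilityMeasure (μ.map (X (p, l))) := Measure.isProbabilityMeasure_map hm.aemeasurable
  rw [integral_fintype Integrable.of_finite]
  refine Finset.sum_congr rfl fun s _ => ?_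
  rw [map_measureReal_apply hm (measurableSet_singleton s), smul_eq_mul, ← hX.2.2 p l s]
  rfl

omit [DecidableEq S] [(i : S) → Fintype (A i)] in
/-- Hoeffding's lemma for one sample. -/
theorem AMDP.IsSampler.lintegral_exp_deviation_le (hX : M.IsSampler μ X) (p : Pair A) (l : ℕ)
    {y : S → ℝ} {B : ℝ} (hy : ∀ s, |y s| ≤ B) (t : ℝ) :
    ∫⁻ ω, ENNReal.ofReal (Real.exp (t * deviation (M.P p) y (X (p, l) ω))) ∂μ ≤
      ENNReal.ofReal (Real.exp (B ^ 2 * t ^ 2 / 2)) := by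
  have hm : Measurable fun ω => y (X (p, l) ω) := Measurable.of_discrete.comp (hX.1 _)
  have hsub := hasSubgaussianMGF_of_mem_Icc (μ := μ) (a := -B) (b := B) hm.aemeasurable
    (Filter.Eventually.of_forall fun ω => abs_le.1 (hy (X (p, l) ω)))
  have hc : (((‖B - -B‖₊ / 2) ^ 2 : NNReal) : ℝ) = B ^ 2 := by
    push_cast
    rw [Real.norm_eq_abs, div_pow, sq_abs]
    ring
  have h1 := hsub.mgf_le t
  rw [hc] at h1
  have hint := hsub.integrable_exp_mul t
  have heq : ∀ ω, y (X (p, l) ω) - ∫ ω, y (X (p, l) ω) ∂μ = deviation (M.P p) y (X (p, l) ω) :=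
    fun ω => by rw [hX.integral_comp]; rfl
  simp only [mgf, heq] at h1 hint
  rw [← ofReal_integral_eq_lintegral_ofReal hint
    (Filter.Eventually.of_forall fun _ => (Real.exp_pos _).le)]
  exact ENNReal.ofReal_le_ofReal h1

/-- `f` depends only on the answers of the sampler with numbers below `L`. -/
def DependsBelow {S : Type} {A : S → Type} {β : Type*} (L : ℕ) (f : (Pair A × ℕ → S) → β) : Prop :=
  ∀ Y Y' : Pair A × ℕ → S, (∀ p l, l < L → Y (p, l) = Y' (p, l)) → f Y = f Y'

theorem DependsBelow.mono {S : Type} {A : S → Type} {β : Type*} {L L' : ℕ}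
    {f : (Pair A × ℕ → S) → β} (hf : DependsBelow L f) (h : L ≤ L') : DependsBelow L' f :=
  fun _ _ hY => hf _ _ fun p l hl => hY p l (hl.trans_le h)

/-- The indices of the answers of the sampler with numbers below `L`. -/
def answersBelow {S : Type} [Fintype S] (A : S → Type) [∀ i, Fintype (A i)] (L : ℕ) :
    Finset (Pair A × ℕ) :=
  Finset.univ ×ˢ Finset.range L

open Classical in
/-- Some continuation of the answers with numbers below `L`. -/
noncomputable def extendAnswers {S : Type} [Fintype S] [Nonempty S] {A : S → Type}
    [∀ i, Fintype (A i)] {L : ℕ} (u : answersBelow A L → S) (q : Pair A × ℕ) : S :=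
  if hq : q ∈ answersBelow A L then u ⟨q, hq⟩ else Classical.arbitrary S

theorem DependsBelow.eq_extendAnswers {S : Type} [Fintype S] [Nonempty S] {A : S → Type}
    [∀ i, Fintype (A i)] {β : Type*} {L : ℕ} {f : (Pair A × ℕ → S) → β} (hf : DependsBelow L f)
    (Y : Pair A × ℕ → S) : f Y = f (extendAnswers fun i : answersBelow A L => Y i) :=
  hf _ _ fun p l hl => by
    have : (p, l) ∈ answersBelow A L := by simp [answersBelow, hl]
    simp [extendAnswers, this]

omit [DecidableEq S] [IsProbabilityMeasure μ] in
-- Such an `f` factors through a finite discrete space of answers, so an arbitrary tie-breaking rule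
-- causes no measurability problem.
theorem AMDP.IsSampler.measurable_comp_of_dependsBelow [Nonempty S] (hX : M.IsSampler μ X) {L : ℕ}
    {β : Type*} [MeasurableSpace β] {f : (Pair A × ℕ → S) → β} (hf : DependsBelow L f) :
    Measurable fun ω => f fun q => X q ω := by
  have h1 : Measurable fun ω => fun i : answersBelow A L => X i ω :=
    measurable_pi_lambda _ fun i => hX.1 i
  have h2 := (Measurable.of_discrete (f := fun u : answersBelow A L → S =>
    f (extendAnswers u))).comp h1
  have h3 : (fun ω => f fun q => X q ω) = (fun u : answersBelow A L → S => f (extendAnswers u)) ∘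
      fun ω => fun i : answersBelow A L => X i ω := funext fun ω => hf.eq_extendAnswers _
  rw [h3]
  exact h2

/-- Splitting over the finitely many values `u` of the past replaces conditional expectation: given
`u`, the chosen pair and the function `y` are fixed, and the answer with number `L` is independent
of the past, so Hoeffding's lemma applies. -/
theorem AMDP.IsSampler.lintegral_mul_exp_deviation_le [Nonempty S] (hX : M.IsSampler μ X) {L : ℕ}
    {F : (Pair A × ℕ → S) → ENNReal} (hF : DependsBelow L F)
    {a : (Pair A × ℕ → S) → Pair A} (ha : DependsBelow L a)
    {y : (Pair A × ℕ → S) → S → ℝ} (hy : DependsBelow L y) {B : ℝ} (hB : ∀ Y s, |y Y s| ≤ B)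
    (t : ℝ) :
    ∫⁻ ω, F (fun q => X q ω) * ENNReal.ofReal (Real.exp (t * deviation (M.P (a fun q => X q ω))
      (y fun q => X q ω) (X (a fun q => X q ω, L) ω))) ∂μ ≤
      (∫⁻ ω, F (fun q => X q ω) ∂μ) * ENNReal.ofReal (Real.exp (B ^ 2 * t ^ 2 / 2)) := by
  classical
  let past : Ω → answersBelow A L → S := fun ω i => X i ω
  have hpast : Measurable past := measurable_pi_lambda _ fun i => hX.1 i
  let ext : (answersBelow A L → S) → Pair A × ℕ → S := extendAnswers
  let ind : (answersBelow A L → S) → Ω → ENNReal := fun u ω => if past ω = u then 1 else 0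
  have hind : ∀ u, Measurable (ind u) := fun u =>
    (Measurable.of_discrete (f := fun w : answersBelow A L → S => if w = u then (1 : ENNReal) else 0)).comp hpast
  let E : (answersBelow A L → S) → Ω → ENNReal := fun u ω => ENNReal.ofReal (Real.exp (t *
    deviation (M.P (a (ext u))) (y (ext u)) (X (a (ext u), L) ω)))
  have hE : ∀ u, Measurable (E u) := fun u =>
    (Measurable.of_discrete (f := fun s : S => ENNReal.ofReal (Real.exp (t *
      deviation (M.P (a (ext u))) (y (ext u)) s)))).comp (hX.1 _)
  have hindep : ∀ u, ∫⁻ ω, ind u ω * E u ω ∂μ = (∫⁻ ω, ind u ω ∂μ) * ∫⁻ ω, E u ω ∂μ := fun u => by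
    have hdisj : Disjoint (answersBelow A L) {(a (ext u), L)} := by
      simp [answersBelow]
    have h1 := hX.2.1.indepFun_finset (answersBelow A L) {(a (ext u), L)} hdisj hX.1
    have h2 := h1.comp
      (Measurable.of_discrete (f := fun w : answersBelow A L → S => if w = u then (1 : ENNReal) else 0))
      (Measurable.of_discrete (f := fun w : (({(a (ext u), L)} : Finset (Pair A × ℕ)) → S) =>
        ENNReal.ofReal (Real.exp (t * deviation (M.P (a (ext u))) (y (ext u))
          (w ⟨(a (ext u), L), Finset.mem_singleton_self _⟩)))))
    exact lintegral_mul_eq_lintegral_mul_lintegral_of_indepFun (hind u) (hE u) h2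
  calc ∫⁻ ω, F (fun q => X q ω) * ENNReal.ofReal (Real.exp (t * deviation (M.P (a fun q => X q ω))
      (y fun q => X q ω) (X (a fun q => X q ω, L) ω))) ∂μ
      = ∫⁻ ω, ∑ u, F (ext u) * (ind u ω * E u ω) ∂μ := by
        refine lintegral_congr fun ω => ?_
        rw [hF.eq_extendAnswers, hy.eq_extendAnswers, ha.eq_extendAnswers]
        simp [ind, E, past, ext]
    _ = ∑ u, F (ext u) * ∫⁻ ω, ind u ω * E u ω ∂μ := by
        rw [lintegral_finsetSum (f := fun u ω => F (ext u) * (ind u ω * E u ω)) _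
          fun u _ => ((hind u).mul (hE u)).const_mul _]
        exact Finset.sum_congr rfl fun u _ => lintegral_const_mul _ ((hind u).mul (hE u))
    _ ≤ ∑ u, F (ext u) * ((∫⁻ ω, ind u ω ∂μ) * ENNReal.ofReal (Real.exp (B ^ 2 * t ^ 2 / 2))) := by
        refine Finset.sum_le_sum fun u _ => ?_
        rw [hindep u]
        gcongr
        exact hX.lintegral_exp_deviation_le _ _ (hB _) t
    _ = (∫⁻ ω, F (fun q => X q ω) ∂μ) * ENNReal.ofReal (Real.exp (B ^ 2 * t ^ 2 / 2)) := by
        simp only [← mul_assoc]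
        rw [← Finset.sum_mul]
        congr 1
        calc ∑ u, F (ext u) * ∫⁻ ω, ind u ω ∂μ = ∫⁻ ω, ∑ u, F (ext u) * ind u ω ∂μ := by
              rw [lintegral_finsetSum (f := fun u ω => F (ext u) * ind u ω) _
                fun u _ => (hind u).const_mul _]
              exact Finset.sum_congr rfl fun u _ => (lintegral_const_mul _ (hind u)).symm
          _ = ∫⁻ ω, F (fun q => X q ω) ∂μ := by
              refine lintegral_congr fun ω => ?_
              rw [hF.eq_extendAnswers]
              simp [ind, past, ext]

theorem dependsBelow_sum_deviation {S : Type} [Fintype S] {A : S → Type} {P : Pair A → S → ℝ}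
    {n : ℕ} {a : ℕ → (Pair A × ℕ → S) → Pair A} (ha : ∀ k, DependsBelow (n + k) (a k))
    {y : ℕ → (Pair A × ℕ → S) → S → ℝ} (hy : ∀ k, DependsBelow (n + k) (y k)) (N : ℕ) :
    DependsBelow (n + N) fun Y => ∑ k ∈ Finset.range N,
      deviation (P (a k Y)) (y k Y) (Y (a k Y, n + k)) := fun Y Y' h =>
  Finset.sum_congr rfl fun k hk => by
    have hk' : k < N := Finset.mem_range.1 hk
    rw [(ha k).mono (by omega) Y Y' h, (hy k).mono (by omega) Y Y' h, h _ _ (by omega)]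

theorem AMDP.IsSampler.lintegral_exp_sum_deviation_le [Nonempty S] (hX : M.IsSampler μ X) {n : ℕ}
    {a : ℕ → (Pair A × ℕ → S) → Pair A} (ha : ∀ k, DependsBelow (n + k) (a k))
    {y : ℕ → (Pair A × ℕ → S) → S → ℝ} (hy : ∀ k, DependsBelow (n + k) (y k)) {B : ℝ}
    (hB : ∀ k Y s, |y k Y s| ≤ B) (t : ℝ) (N : ℕ) :
    ∫⁻ ω, ENNReal.ofReal (Real.exp (t * ∑ k ∈ Finset.range N,
      deviation (M.P (a k fun q => X q ω)) (y k fun q => X q ω)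
        (X (a k fun q => X q ω, n + k) ω))) ∂μ ≤
      ENNReal.ofReal (Real.exp (N * (B ^ 2 * t ^ 2 / 2))) := by
  induction N with
  | zero => simp
  | succ N ih =>
    let F : (Pair A × ℕ → S) → ENNReal := fun Y => ENNReal.ofReal (Real.exp (t *
      ∑ k ∈ Finset.range N, deviation (M.P (a k Y)) (y k Y) (Y (a k Y, n + k))))
    have hF : DependsBelow (n + N) F := fun Y Y' h =>
      congrArg (fun x => ENNReal.ofReal (Real.exp (t * x)))
        (dependsBelow_sum_deviation ha hy N Y Y' h)
    have hstep := hX.lintegral_mul_exp_deviation_le hF (ha N) (hy N) (hB N) t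
    calc _ = ∫⁻ ω, F (fun q => X q ω) * ENNReal.ofReal (Real.exp (t *
            deviation (M.P (a N fun q => X q ω)) (y N fun q => X q ω)
              (X (a N fun q => X q ω, n + N) ω))) ∂μ := by
          refine lintegral_congr fun ω => ?_
          rw [← ENNReal.ofReal_mul (Real.exp_pos _).le, ← Real.exp_add, ← mul_add,
            Finset.sum_range_succ]
      _ ≤ _ := hstep
      _ ≤ _ := by
        refine (mul_le_mul_left ih _).trans (le_of_eq ?_)
        rw [← ENNReal.ofReal_mul (Real.exp_pos _).le, ← Real.exp_add]
        push_cast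
        ring_nf

/-- The Azuma–Hoeffding inequality for adaptively chosen samples. -/
theorem AMDP.IsSampler.measureReal_sum_deviation_ge_le [Nonempty S] (hX : M.IsSampler μ X) {n : ℕ}
    {a : ℕ → (Pair A × ℕ → S) → Pair A} (ha : ∀ k, DependsBelow (n + k) (a k))
    {y : ℕ → (Pair A × ℕ → S) → S → ℝ} (hy : ∀ k, DependsBelow (n + k) (y k)) {B : ℝ}
    (hB0 : 0 < B) (hB : ∀ k Y s, |y k Y s| ≤ B) {N : ℕ} {τ : ℝ} (hτ : 0 ≤ τ) :
    μ.real {ω | τ * N ≤ ∑ k ∈ Finset.range N, deviation (M.P (a k fun q => X q ω))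
      (y k fun q => X q ω) (X (a k fun q => X q ω, n + k) ω)} ≤
      Real.exp (-(N * τ ^ 2 / (2 * B ^ 2))) := by
  set D : Ω → ℝ := fun ω => ∑ k ∈ Finset.range N, deviation (M.P (a k fun q => X q ω))
    (y k fun q => X q ω) (X (a k fun q => X q ω, n + k) ω) with hD
  have hDm : Measurable D :=
    hX.measurable_comp_of_dependsBelow (dependsBelow_sum_deviation (P := M.P) ha hy N)
  -- The minimiser of the Chernoff exponent `N B² t² / 2 - t τ N`.
  set t := τ / B ^ 2 with ht
  have ht0 : 0 ≤ t := by positivity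
  set c := ENNReal.ofReal (Real.exp (t * (τ * N))) with hc
  have hc0 : c ≠ 0 := by simp [hc, Real.exp_pos]
  have h1 := hX.lintegral_exp_sum_deviation_le ha hy hB t N
  have h2 : μ {ω | τ * N ≤ D ω} ≤ (∫⁻ ω, ENNReal.ofReal (Real.exp (t * D ω)) ∂μ) / c := by
    refine (measure_mono fun ω hω => ?_).trans (meas_ge_le_lintegral_div
      ((hDm.const_mul t).exp.ennreal_ofReal.aemeasurable) hc0 ENNReal.ofReal_ne_top)
    exact ENNReal.ofReal_le_ofReal (Real.exp_le_exp.2 (mul_le_mul_of_nonneg_left hω ht0))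
  have h3 : μ {ω | τ * N ≤ D ω} ≤ ENNReal.ofReal (Real.exp (-(N * τ ^ 2 / (2 * B ^ 2)))) := by
    refine h2.trans ((ENNReal.div_le_div_right h1 _).trans (le_of_eq ?_))
    rw [hc, ← ENNReal.ofReal_div_of_pos (Real.exp_pos _), ← Real.exp_sub]
    congr 2
    rw [ht]
    field_simp
    ring
  exact ENNReal.toReal_le_of_le_ofReal (Real.exp_pos _).le h3

end Concentration

/-! ## The probability of an optimal output -/

section Vertices

variable {S : Type} [Fintype S] [DecidableEq S] {A : S → Type}

/-- A vertex of the box `[-B, B]^S`. -/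
def boxVertex (B : ℝ) (σ : S → Bool) (j : S) : ℝ := if σ j then B else -B

omit [Fintype S] [DecidableEq S] in
theorem boxVertex_mem {B : ℝ} (hB : 0 ≤ B) (σ : S → Bool) (j : S) :
    boxVertex B σ j ∈ Set.Icc (-B) B := by
  unfold boxVertex
  split_ifs <;> constructor <;> linarith

omit [DecidableEq S] in
-- The signs of the coefficients select the maximising vertex.
theorem exists_sum_mul_le_boxVertex (B : ℝ) (c : S → ℝ) : ∃ σ : S → Bool, ∀ w : S → ℝ,
    (∀ j, w j ∈ Set.Icc (-B) B) → ∑ j, c j * w j ≤ ∑ j, c j * boxVertex B σ j := by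
  refine ⟨fun j => decide (0 ≤ c j), fun w hw => Finset.sum_le_sum fun j _ => ?_⟩
  unfold boxVertex
  by_cases h : 0 ≤ c j
  · simpa [h] using mul_le_mul_of_nonneg_left (hw j).2 h
  · simpa [h] using mul_le_mul_of_nonpos_left (hw j).1 (not_le.1 h).le

theorem deviation_eq_sum (p y : S → ℝ) (s : S) :
    deviation p y s = ∑ j, ((if s = j then 1 else 0) - p j) * y j := by
  simp [deviation, sub_mul, Finset.sum_sub_distrib]

omit [DecidableEq S] in
theorem deviation_neg (p y : S → ℝ) (s : S) :
    deviation p (fun j => -y j) s = -deviation p y s := by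
  simp only [deviation, mul_neg, Finset.sum_neg_distrib]
  ring

theorem sum_deviation_eq_empirical (P : Pair A → S → ℝ) {n : ℕ} (hn : 0 < n)
    (Y : Pair A × ℕ → S) (a : Pair A) (h : S → ℝ) :
    ∑ l ∈ Finset.range n, deviation (P a) h (Y (a, l)) =
      n * ∑ j, (empirical n Y a j - P a j) * h j := by
  have hn' : (n : ℝ) ≠ 0 := by exact_mod_cast hn.ne'
  simp only [deviation_eq_sum]
  rw [Finset.sum_comm, Finset.mul_sum]
  refine Finset.sum_congr rfl fun j _ => ?_
  rw [← Finset.sum_mul, Finset.sum_sub_distrib, Finset.sum_const, Finset.card_range, nsmul_eq_mul,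
    empirical]
  field_simp

theorem abs_empirical_sub_le {P : Pair A → S → ℝ} {n : ℕ} (hn : 0 < n) {Y : Pair A × ℕ → S}
    {a : Pair A} {B δ : ℝ} (hδ : ∀ σ : S → Bool,
      ∑ l ∈ Finset.range n, deviation (P a) (boxVertex B σ) (Y (a, l)) < δ * n)
    {h : S → ℝ} (hh : ∀ j, h j ∈ Set.Icc (-B) B) :
    |∑ j, (empirical n Y a j - P a j) * h j| ≤ δ := by
  have hn' : (0 : ℝ) < n := by exact_mod_cast hn
  obtain ⟨σ, hσ⟩ := exists_sum_mul_le_boxVertex B fun j => empirical n Y a j - P a j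
  have h1 := hδ σ
  rw [sum_deviation_eq_empirical P hn, mul_comm] at h1
  have h2 := lt_of_mul_lt_mul_right h1 hn'.le
  refine abs_le.2 ⟨?_, (hσ h hh).trans h2.le⟩
  -- The box is symmetric, so the upper bound at `-h` is the lower bound at `h`.
  have h3 := hσ (fun j => -h j) fun j => ⟨by linarith [(hh j).2], by linarith [(hh j).1]⟩
  simp only [mul_neg, Finset.sum_neg_distrib] at h3
  linarith

variable [∀ i, Fintype (A i)] [∀ i, DecidableEq (A i)]

omit [(i : S) → Fintype (A i)] [(i : S) → DecidableEq (A i)] in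
theorem exists_noise_boxVertex_le (P : Pair A → S → ℝ) (sel : (Pair A → ℝ) → Pair A) (thr : ℝ)
    (Y : Pair A × ℕ → S) (n : ℕ) (x : ℕ → NetMem A) (N : ℕ) (B : ℝ) : ∃ σ : S → Bool, ∀ w : S → ℝ,
    (∀ j, w j ∈ Set.Icc (-B) B) →
      noise P sel thr Y n x (boxVertex B σ) N ≤ noise P sel thr Y n x w N := by
  classical
  -- For a fixed run the iterates do not depend on `w`, so the noise is affine in `w` with slope
  -- `-c`.
  let c : S → ℝ := fun j => ∑ l ∈ Finset.range N, if (x l).Productive sel thr then 0 else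
    (if Y ((x l).top sel, n + l) = j then 1 else 0) - P ((x l).top sel) j
  have hlin : ∀ w, noise P sel thr Y n x w N =
      noise P sel thr Y n x (fun _ => 0) N - ∑ j, c j * w j := fun w => by
    simp only [c, Finset.sum_mul]
    rw [Finset.sum_comm, noise, noise, ← Finset.sum_sub_distrib]
    refine Finset.sum_congr rfl fun l _ => ?_
    by_cases hp : (x l).Productive sel thr
    · simp [NetMem.noiseFun, hp]
    · simp only [NetMem.noiseFun, hp, if_false, deviation_eq_sum, ← Finset.sum_sub_distrib]
      exact Finset.sum_congr rfl fun j _ => by ring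
  obtain ⟨σ, hσ⟩ := exists_sum_mul_le_boxVertex B c
  exact ⟨σ, fun w hw => by rw [hlin (boxVertex B σ), hlin w]; linarith [hσ w hw]⟩

end Vertices

/-! ### Failure probabilities and the union bound -/

section Probability

open MeasureTheory ProbabilityTheory

variable {S : Type} [Fintype S] [DecidableEq S] {A : S → Type} [∀ i, Fintype (A i)]
  [∀ i, DecidableEq (A i)] {m : ℕ}

/-- Preprocessing and the first `k` iterations use only answers numbered below `n + k`; the answer
read in iteration `k` is thus fresh. -/
theorem iterates_dependsBelow (η thr B : ℝ) (host : Pair A → Fin m) (sel : (Pair A → ℝ) → Pair A)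
    (r : Pair A → ℝ) (n k : ℕ) : DependsBelow (n + k) fun Y : Pair A × ℕ → S =>
      (iterates η thr B host sel r (empirical n Y) n Y k).val := fun Y Y' h => by
  have hemp : empirical n Y = empirical n Y' := by
    ext p s
    simp only [empirical]
    congr 1
    exact Finset.sum_congr rfl fun l hl => by
      rw [h p l (by have := Finset.mem_range.1 hl; omega)]
  simp only [hemp]
  induction k with
  | zero => rfl
  | succ k ih =>
    simp only [iterates]
    rw [ih fun p l hl => h p l (by omega)]
    congr 2
    ext a
    exact h a _ (by omega)

variable [MeasurableSpace S] [MeasurableSingletonClass S] [Nonempty S]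
  {Ω : Type*} [MeasurableSpace Ω] {μ : Measure Ω} [IsProbabilityMeasure μ]
  {M : AMDP S A} {X : Pair A × ℕ → Ω → S}

omit [(i : S) → DecidableEq (A i)] in
theorem measureReal_empirical_bad_le (hX : M.IsSampler μ X) {B δ : ℝ} (hB : 0 < B) (hδ : 0 ≤ δ)
    (n : ℕ) : μ.real (⋃ q : Pair A × (S → Bool), {ω | δ * n ≤ ∑ l ∈ Finset.range n,
      deviation (M.P q.1) (boxVertex B q.2) (X (q.1, l) ω)}) ≤
      Fintype.card (Pair A) * 2 ^ Fintype.card S * Real.exp (-(n * δ ^ 2 / (2 * B ^ 2))) := by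
  refine (measureReal_iUnion_fintype_le _).trans ?_
  have h1 : ∀ q : Pair A × (S → Bool), μ.real {ω | δ * n ≤ ∑ l ∈ Finset.range n,
      deviation (M.P q.1) (boxVertex B q.2) (X (q.1, l) ω)} ≤
      Real.exp (-(n * δ ^ 2 / (2 * B ^ 2))) := fun q => by
    have := hX.measureReal_sum_deviation_ge_le (n := 0) (a := fun _ _ => q.1)
      (fun _ _ _ _ => rfl) (y := fun _ _ => boxVertex B q.2) (fun _ _ _ _ => rfl) hB
      (fun _ _ s => abs_le.2 (boxVertex_mem hB.le q.2 s)) (N := n) hδ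
    simpa only [zero_add] using this
  refine (Finset.sum_le_sum fun q _ => h1 q).trans (le_of_eq ?_)
  rw [Finset.sum_const, Finset.card_univ, nsmul_eq_mul, Fintype.card_prod, Fintype.card_fun,
    Fintype.card_bool]
  push_cast
  ring

theorem measureReal_noise_bad_le (hX : M.IsSampler μ X) {B δ : ℝ} (hB : 0 < B) (hδ : 0 ≤ δ)
    (η thr : ℝ) (host : Pair A → Fin m) (sel : (Pair A → ℝ) → Pair A) (r : Pair A → ℝ) (n N : ℕ) :
    μ.real (⋃ σ : S → Bool, {ω | noise M.P sel thr (fun q => X q ω) n (fun l =>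
        (iterates η thr B host sel r (empirical n fun q => X q ω) n (fun q => X q ω) l).val)
        (boxVertex B σ) N ≤ -(δ * N)}) ≤
      2 ^ Fintype.card S * Real.exp (-(N * δ ^ 2 / (2 * (2 * B) ^ 2))) := by
  refine (measureReal_iUnion_fintype_le _).trans ?_
  let x : ℕ → (Pair A × ℕ → S) → NetMem A := fun l Y =>
    (iterates η thr B host sel r (empirical n Y) n Y l).val
  have hx : ∀ l, DependsBelow (n + l) (x l) := fun l => iterates_dependsBelow η thr B host sel r n l
  have h1 : ∀ σ : S → Bool, μ.real {ω | noise M.P sel thr (fun q => X q ω) n (fun l =>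
        (iterates η thr B host sel r (empirical n fun q => X q ω) n (fun q => X q ω) l).val)
        (boxVertex B σ) N ≤ -(δ * N)} ≤
      Real.exp (-(N * δ ^ 2 / (2 * (2 * B) ^ 2))) := fun σ => by
    have hb : ∀ k Y s, |-(x k Y).noiseFun sel thr (boxVertex B σ) s| ≤ 2 * B := fun k Y s => by
      rw [abs_neg, NetMem.noiseFun]
      split_ifs
      · simpa using hB.le
      · have hv := (iterates_valid (η := η) (thr := thr) (host := host) (sel := sel) (r := r)
          (Pt := empirical n Y) (n := n) (Y := Y) hB.le k).h_mem s
        have hw := boxVertex_mem hB.le σ s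
        exact abs_le.2 ⟨by linarith [hv.1, hw.2], by linarith [hv.2, hw.1]⟩
    -- Negating the noise function turns the lower tail into an upper one; its bound `2 * B` is the
    -- largest coordinate difference of two points of the box.
    have := hX.measureReal_sum_deviation_ge_le (n := n) (a := fun k Y => (x k Y).top sel)
      (fun k Y Y' h => by simp only [hx k Y Y' h])
      (y := fun k Y j => -(x k Y).noiseFun sel thr (boxVertex B σ) j)
      (fun k Y Y' h => by simp only [hx k Y Y' h]) (by positivity : 0 < 2 * B) hb (N := N) hδ
    refine le_of_eq_of_le ?_ this
    congr 1
    ext ω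
    simp only [Set.mem_ofPred_eq, deviation_neg, Finset.sum_neg_distrib]
    rw [le_neg]
    rfl
  refine (Finset.sum_le_sum fun q _ => h1 q).trans (le_of_eq ?_)
  rw [Finset.sum_const, Finset.card_univ, nsmul_eq_mul, Fintype.card_fun, Fintype.card_bool]
  push_cast
  ring

theorem two_pow_le_exp (k : ℕ) : (2 : ℝ) ^ k ≤ Real.exp k := by
  have h : (2 : ℝ) ≤ Real.exp 1 := by linarith [Real.add_one_le_exp (1 : ℝ)]
  calc (2 : ℝ) ^ k ≤ Real.exp 1 ^ k := pow_le_pow_left₀ (by norm_num) h k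
    _ = Real.exp k := by rw [← Real.exp_nat_mul, mul_one]

/-- The constant `32 = 2 * 4 ^ 2` cancels the denominator of the exponent. Then `s` pays for the
vertices and the logarithm for the pairs and the confidence. -/
theorem empirical_bad_bound {t s c σ ε n : ℝ} {k : ℕ} (hk : s = k) (ht : 1 ≤ t) (hc : 0 < c)
    (hσ : 0 < σ) (hε : 0 < ε)
    (hn : 32 * (t ^ 2 * (s + Real.log (c / (σ / 2))) / (ε / 16) ^ 2) ≤ n) :
    c * 2 ^ k * Real.exp (-(n * (ε / 16) ^ 2 / (2 * (4 * t) ^ 2))) ≤ σ / 2 := by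
  have h1 : s + Real.log (c / (σ / 2)) ≤ n * (ε / 16) ^ 2 / (2 * (4 * t) ^ 2) := by
    rw [le_div_iff₀ (by positivity)]
    rw [← mul_div_assoc, div_le_iff₀ (by positivity)] at hn
    linarith
  calc c * 2 ^ k * Real.exp (-(n * (ε / 16) ^ 2 / (2 * (4 * t) ^ 2)))
      ≤ c * Real.exp k * Real.exp (-(s + Real.log (c / (σ / 2)))) := by
        gcongr
        exact two_pow_le_exp k
    _ = σ / 2 := by
      rw [neg_add, Real.exp_add, Real.exp_neg (Real.log _), Real.exp_log (by positivity), hk,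
        Real.exp_neg]
      have := Real.exp_ne_zero (k : ℝ)
      field_simp

theorem noise_bad_bound {t s σ ε N : ℝ} {k : ℕ} (hk : s = k) (hk1 : 1 ≤ k) (ht : 1 ≤ t)
    (hσ : 0 < σ) (hσ2 : σ < 1 / 2) (hε : 0 < ε)
    (hN : 6291456 * (t ^ 2 * s * Real.log (1 / σ) / ε ^ 2) ≤ N) :
    2 ^ k * Real.exp (-(N * (ε / 128) ^ 2 / (2 * (2 * (4 * t)) ^ 2))) ≤ σ / 2 := by
  set l := Real.log (1 / σ) with hl
  have hk1' : (1 : ℝ) ≤ k := by exact_mod_cast hk1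
  have hl2 : Real.log 2 ≤ l :=
    Real.log_le_log (by norm_num) (by rw [le_div_iff₀ hσ]; linarith)
  have hl0 : 0 ≤ l := (Real.log_nonneg (by norm_num)).trans hl2
  -- Here `6291456 = 3 * 128 * 128 ^ 2`. One of the three copies of `s * l` absorbs `2 ^ k`, as `log
  -- 2 ≤ l`; the other two leave at most `σ ^ 2 ≤ σ / 2`.
  have h1 : 3 * s * l ≤ N * (ε / 128) ^ 2 / (2 * (2 * (4 * t)) ^ 2) := by
    rw [le_div_iff₀ (by positivity)]
    rw [← mul_div_assoc, div_le_iff₀ (by positivity)] at hN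
    linarith
  have h2 : (2 : ℝ) ^ k ≤ Real.exp (k * l) := by
    calc (2 : ℝ) ^ k = Real.exp (k * Real.log 2) := by
          rw [Real.exp_nat_mul, Real.exp_log (by norm_num)]
      _ ≤ _ := Real.exp_le_exp.2 (by gcongr)
  have hexp : Real.exp (-l) = σ := by
    rw [hl, one_div, Real.log_inv, neg_neg, Real.exp_log hσ]
  calc 2 ^ k * Real.exp (-(N * (ε / 128) ^ 2 / (2 * (2 * (4 * t)) ^ 2)))
      ≤ Real.exp (k * l) * Real.exp (-(3 * s * l)) := by gcongr
    _ = Real.exp (-(2 * (k * l))) := by rw [← Real.exp_add, hk]; ring_nf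
    _ ≤ Real.exp (-l + -l) := Real.exp_le_exp.2 (by nlinarith)
    _ = σ * σ := by rw [Real.exp_add, hexp]
    _ ≤ σ / 2 := by nlinarith

/-- The output is `ε`-optimal with probability at least `1 - σ`. -/
theorem measureReal_isEpsOptimal_ge (hM : M.Mixing) {sel : (Pair A → ℝ) → Pair A}
    (hsel : ∀ (g : Pair A → ℝ) (a : Pair A), g a ≤ g (sel g)) {π₀ : Pair A → ℝ}
    (h₀ : IsPolicy π₀) {host : Pair A → Fin m} {ε σ : ℝ} (hε : 0 < ε) (hσ : 0 < σ)
    (hσ2 : σ < 1 / 2) {n : ℕ} (hn : 32 * ((M.tmix : ℝ) ^ 2 *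
      (Fintype.card S + Real.log (Fintype.card (Pair A) / (σ / 2))) / (ε / 16) ^ 2) ≤ n) {N : ℕ}
    (hN : 6291456 * ((M.tmix : ℝ) ^ 2 * Fintype.card S * Real.log (1 / σ) / ε ^ 2) ≤ N)
    (hX : M.IsSampler μ X) :
    1 - σ ≤ μ.real {ω | M.IsEpsOptimal ε
      (parallelAMDP M ε n N host sel π₀ fun q => X q ω).val} := by
  have ht1 : (1 : ℝ) ≤ M.tmix := by exact_mod_cast hM.one_le_tmix h₀
  have hB : (0 : ℝ) < 4 * M.tmix := by linarith
  have hS1 : (1 : ℝ) ≤ Fintype.card S := by exact_mod_cast Fintype.card_pos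
  have : Nonempty (Pair A) := ⟨sel fun _ => 0⟩
  have hA1 : (1 : ℝ) ≤ Fintype.card (Pair A) := by exact_mod_cast Fintype.card_pos
  have hlog2 : (0.69 : ℝ) ≤ Real.log (1 / σ) := by
    have := Real.log_two_gt_d9
    have : Real.log 2 ≤ Real.log (1 / σ) :=
      Real.log_le_log (by norm_num) (by rw [le_div_iff₀ hσ]; linarith)
    linarith
  have hlogA : 0 ≤ Real.log (Fintype.card (Pair A) / (σ / 2)) :=
    Real.log_nonneg (by rw [le_div_iff₀ (by positivity)]; linarith)
  have hn0 : 0 < n := by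
    have : (0 : ℝ) < n := lt_of_lt_of_le (by positivity) hn
    exact_mod_cast this
  have hN2 : 69632 * ((M.tmix : ℝ) ^ 2 * Fintype.card S / ε ^ 2) ≤ N := by
    refine le_trans ?_ hN
    have h0 : 0 ≤ (M.tmix : ℝ) ^ 2 * Fintype.card S / ε ^ 2 := by positivity
    rw [show (M.tmix : ℝ) ^ 2 * Fintype.card S * Real.log (1 / σ) / ε ^ 2 =
      (M.tmix : ℝ) ^ 2 * Fintype.card S / ε ^ 2 * Real.log (1 / σ) by ring]
    nlinarith
  have hbad1 := (measureReal_empirical_bad_le hX hB (δ := ε / 16) (by positivity) n).trans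
    (empirical_bad_bound rfl ht1 (by linarith) hσ hε hn)
  have hbad2 := (measureReal_noise_bad_le hX hB (δ := ε / 128) (by positivity) (ε / 64)
    (ε / 16 + ε / 16) host sel M.r n N).trans
    (noise_bad_bound rfl Fintype.card_pos ht1 hσ hσ2 hε hN)
  set bad1 := ⋃ q : Pair A × (S → Bool), {ω | ε / 16 * n ≤ ∑ l ∈ Finset.range n,
      deviation (M.P q.1) (boxVertex (4 * M.tmix) q.2) (X (q.1, l) ω)} with hb1
  set bad2 := ⋃ σ : S → Bool, {ω | noise M.P sel (ε / 16 + ε / 16) (fun q => X q ω) n (fun l =>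
        (iterates (ε / 64) (ε / 16 + ε / 16) (4 * M.tmix) host sel M.r
          (empirical n fun q => X q ω) n (fun q => X q ω) l).val)
        (boxVertex (4 * M.tmix) σ) N ≤ -(ε / 128 * N)} with hb2
  set good := {ω | M.IsEpsOptimal ε (parallelAMDP M ε n N host sel π₀ fun q => X q ω).val}
  -- Covering the space and using subadditivity avoids any measurability of the set of good
  -- outcomes.
  have hcover : (Set.univ : Set Ω) ⊆ (bad1 ∪ bad2) ∪ good := fun ω _ => by
    by_cases h1 : ω ∈ bad1
    · exact Or.inl (Or.inl h1)
    by_cases h2 : ω ∈ bad2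
    · exact Or.inl (Or.inr h2)
    simp only [hb1, hb2, Set.mem_iUnion, Set.mem_ofPred_eq, not_exists, not_le, Prod.forall] at h1 h2
    refine Or.inr (isEpsOptimal_parallelAMDP hM hsel h₀ hε
      (fun a h hh => abs_empirical_sub_le hn0 (h1 a) hh) (fun w hw => ?_) hN2)
    obtain ⟨τ, hτ⟩ := exists_noise_boxVertex_le M.P sel (ε / 16 + ε / 16) (fun q => X q ω) n
      (fun l => (iterates (ε / 64) (ε / 16 + ε / 16) (4 * M.tmix) host sel M.r
          (empirical n fun q => X q ω) n (fun q => X q ω) l).val) N (4 * M.tmix)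
    exact (h2 τ).le.trans (hτ w hw)
  have h1 : 1 ≤ μ.real ((bad1 ∪ bad2) ∪ good) := by
    rw [← probReal_univ (μ := μ)]
    exact measureReal_mono hcover
  have h2 := measureReal_union_le (μ := μ) (bad1 ∪ bad2) good
  have h3 := measureReal_union_le (μ := μ) bad1 bad2
  linarith

end Probability

/-! ## The cost of the parallel algorithm -/

theorem Timed.bind_ops {α β : Type} (x : Timed α) (f : α → Timed β) :
    (x >>= f).ops = x.ops + (f x.val).ops := rfl

theorem Timed.pure_ops {α : Type} (z : α) : (pure z : Timed α).ops = 0 := rfl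

/-- The cost is at most that of `k` elementary operations on every node, with `a` nodes of which at
most `b` are served by one worker. -/
structure Cost.Bounded (a b k : ℕ) (x : Cost) : Prop where
  work : x.work ≤ k * a
  samples : x.samples ≤ k * a
  depth : x.depth ≤ k
  time : x.time ≤ k * b

namespace Cost.Bounded

variable {a b k l : ℕ} {x y : Cost}

theorem mono (hx : x.Bounded a b k) (h : k ≤ l) : x.Bounded a b l :=
  ⟨hx.work.trans (Nat.mul_le_mul_right _ h), hx.samples.trans (Nat.mul_le_mul_right _ h),
    hx.depth.trans h, hx.time.trans (Nat.mul_le_mul_right _ h)⟩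

theorem bind {α β : Type} {x : Net α} {f : α → Net β} (hx : x.cost.Bounded a b k)
    (hf : (f x.val).cost.Bounded a b l) : (x >>= f).cost.Bounded a b (k + l) := by
  refine ⟨?_, ?_, Nat.add_le_add hx.depth hf.depth, ?_⟩ <;> rw [add_mul]
  exacts [Nat.add_le_add hx.work hf.work, Nat.add_le_add hx.samples hf.samples,
    Nat.add_le_add hx.time hf.time]

theorem pure {α : Type} (z : α) : (Pure.pure z : Net α).cost.Bounded a b 0 :=
  ⟨Nat.zero_le _, Nat.zero_le _, Nat.zero_le _, Nat.zero_le _⟩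

theorem onOne (ha : 1 ≤ a) (hb : 1 ≤ b) {α : Type} (t : Timed α) (ht : t.ops ≤ k) :
    (Net.onOne t).cost.Bounded a b k :=
  ⟨ht.trans (Nat.le_mul_of_pos_right _ ha), Nat.zero_le _, ht,
    ht.trans (Nat.le_mul_of_pos_right _ hb)⟩

theorem sample (ha : 1 ≤ a) (hb : 1 ≤ b) {α : Type} (s : α) :
    (Net.sample s).cost.Bounded a b 1 :=
  ⟨by simpa [Net.sample] using ha, by simpa [Net.sample] using ha, le_rfl,
    by simpa [Net.sample] using hb⟩

variable {ι : Type} [Fintype ι] {m : ℕ} {host : ι → Fin m}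

theorem onAll (ha : Fintype.card ι = a) (hb : ∀ w, #{i | host i = w} ≤ b) {α : Type}
    (t : ι → Timed α) (ht : ∀ i, (t i).ops ≤ k) : (Net.onAll host t).cost.Bounded a b k := by
  refine ⟨?_, Nat.zero_le _, Finset.sup_le fun i _ => ht i, ?_⟩
  · refine (Finset.sum_le_card_nsmul _ _ k fun i _ => ht i).trans (le_of_eq ?_)
    rw [Finset.card_univ, ha, smul_eq_mul, mul_comm]
  · change (Finset.univ.sup fun w : Fin m => ∑ i with host i = w, (t i).ops) ≤ k * b
    refine Finset.sup_le fun w _ => (Finset.sum_le_card_nsmul _ _ k fun i _ => ht i).trans ?_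
    rw [smul_eq_mul, mul_comm]
    exact Nat.mul_le_mul_left _ (hb w)

theorem broadcast (ha : Fintype.card ι = a) (ha1 : 1 ≤ a) (hb : ∀ w, #{i | host i = w} ≤ b)
    (hb1 : 1 ≤ b) {α : Type} (z : α) : (Net.broadcast host z).cost.Bounded a b 2 :=
  bind (l := 1) (onOne ha1 hb1 _ le_rfl)
    (bind (l := 0) (onAll ha hb _ fun _ => le_rfl) (pure _))

theorem argmax (ha : Fintype.card ι = a) (ha1 : 1 ≤ a) (hb : ∀ w, #{i | host i = w} ≤ b)
    (hb1 : 1 ≤ b) (sel : (ι → ℝ) → ι) (g : ι → ℝ) : (Net.argmax host sel g).cost.Bounded a b 2 :=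
  bind (l := 1) (onAll ha hb _ fun _ => le_rfl) (onOne ha1 hb1 _ le_rfl)

end Cost.Bounded

section AlgorithmCost

open Cost.Bounded

variable {S : Type} [Fintype S] [DecidableEq S] {A : S → Type} [∀ i, Fintype (A i)]
  [∀ i, DecidableEq (A i)] {m : ℕ} {host : Pair A → Fin m} {b : ℕ}

omit [Fintype S] [∀ i, Fintype (A i)] in
theorem nonproductiveUpdate_ops (row : S → ℝ) (c a : Pair A) (x : NodeMem)
    (i s : S) (dv di ds : ℝ) : (nonproductiveUpdate row c a x i s dv di ds).ops = 17 := by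
  simp only [nonproductiveUpdate, Timed.bind_ops, Timed.pure_ops, Timed.ind, Timed.eq, Timed.tick, Timed.load,
    Timed.sub, Timed.add, Timed.mul, Nat.reduceAdd]

omit [DecidableEq S] [(i : S) → DecidableEq (A i)] in
theorem productiveStep_cost_bounded (hA : 1 ≤ Fintype.card (Pair A))
    (hb : ∀ w, #{a | host a = w} ≤ b) (hb1 : 1 ≤ b) (η : ℝ) (x : NetMem A) :
    (productiveStep η host x).cost.Bounded (Fintype.card (Pair A)) b 8 := by
  refine bind (k := 4) (l := 4) (onOne hA hb1 _ le_rfl) ?_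
  refine bind (k := 2) (l := 2) (broadcast rfl hA hb hb1 _) ?_
  exact bind (k := 2) (l := 0) (onAll rfl hb _ fun _ => le_rfl) (pure _)

/-- The 49 operations are 4 for passing the pair, sample and state, `4 + 14` on the head, five
broadcasts of 2, and 17 on each node. -/
theorem nonproductiveStep_cost_bounded (hA : 1 ≤ Fintype.card (Pair A))
    (hb : ∀ w, #{a | host a = w} ≤ b) (hb1 : 1 ≤ b) (η B : ℝ) (Pt : Pair A → S → ℝ)
    (smp : Pair A → S) (a : Pair A) (x : NetMem A) :
    (nonproductiveStep η B host Pt smp a x).cost.Bounded (Fintype.card (Pair A)) b 49 := by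
  refine bind (k := 1) (l := 48) (onOne hA hb1 _ le_rfl) ?_
  refine bind (k := 1) (l := 47) (sample hA hb1 _) ?_
  refine bind (k := 1) (l := 46) (onOne hA hb1 _ le_rfl) ?_
  refine bind (k := 1) (l := 45) (onOne hA hb1 _ le_rfl) ?_
  refine bind (k := 4) (l := 41) (onOne hA hb1 _ le_rfl) ?_
  refine bind (k := 14) (l := 27) (onOne hA hb1 _ le_rfl) ?_
  refine bind (k := 2) (l := 25) (broadcast rfl hA hb hb1 _) ?_
  refine bind (k := 2) (l := 23) (broadcast rfl hA hb hb1 _) ?_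
  refine bind (k := 2) (l := 21) (broadcast rfl hA hb hb1 _) ?_
  refine bind (k := 2) (l := 19) (broadcast rfl hA hb hb1 _) ?_
  refine bind (k := 2) (l := 17) (broadcast rfl hA hb hb1 _) ?_
  exact bind (k := 17) (l := 0) (onAll rfl hb _ fun _ => (nonproductiveUpdate_ops ..).le) (pure _)

theorem iteration_cost_bounded (hA : 1 ≤ Fintype.card (Pair A))
    (hb : ∀ w, #{a | host a = w} ≤ b) (hb1 : 1 ≤ b) (η thr B : ℝ) (sel : (Pair A → ℝ) → Pair A)
    (Pt : Pair A → S → ℝ) (smp : Pair A → S) (x : NetMem A) :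
    (iteration η thr B host sel Pt smp x).cost.Bounded (Fintype.card (Pair A)) b 55 := by
  refine bind (k := 2) (l := 53) (broadcast rfl hA hb hb1 _) ?_
  refine bind (k := 1) (l := 52) (onAll rfl hb _ fun _ => le_rfl) ?_
  refine bind (k := 2) (l := 50) (argmax rfl hA hb hb1 _ _) ?_
  refine bind (k := 1) (l := 49) (onOne hA hb1 _ le_rfl) ?_
  split
  · exact (productiveStep_cost_bounded hA hb hb1 η x).mono (by decide)
  · exact nonproductiveStep_cost_bounded hA hb hb1 η B Pt smp _ x

omit [DecidableEq S] [(i : S) → DecidableEq (A i)] in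
theorem extractPolicy_cost_bounded (hb : ∀ w, #{a | host a = w} ≤ b) (π₀ : Pair A → ℝ)
    (x : NetMem A) : (extractPolicy host π₀ x).cost.Bounded (Fintype.card (Pair A)) b 4 := by
  refine onAll rfl hb _ fun a => ?_
  have h : ∀ (c : Bool) (t t' : Timed ℝ), t.ops = 1 → t'.ops = 1 →
      1 + (1 + (1 + (if c = true then t else t').ops)) ≤ 4 := fun c t t' h h' => by
    split_ifs <;> omega
  exact h _ _ _ rfl rfl

theorem iterates_cost_bounded (hA : 1 ≤ Fintype.card (Pair A))
    (hb : ∀ w, #{a | host a = w} ≤ b) (hb1 : 1 ≤ b) (η thr B : ℝ) (sel : (Pair A → ℝ) → Pair A)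
    (r : Pair A → ℝ) (Pt : Pair A → S → ℝ) (n : ℕ) (Y : Pair A × ℕ → S) (k : ℕ) :
    let c := (iterates η thr B host sel r Pt n Y k).cost
    c.work ≤ (1 + 55 * k) * Fintype.card (Pair A) ∧
      c.samples ≤ (1 + 55 * k) * Fintype.card (Pair A) ∧
      c.depth ≤ 55 ∧ c.time ≤ (1 + 55 * k) * b := by
  intro c
  induction k with
  | zero =>
    have h : c.Bounded (Fintype.card (Pair A)) b 1 :=
      bind (k := 1) (l := 0) (onAll rfl hb _ fun _ => le_rfl) (pure _)
    exact ⟨by simpa using h.work, by simpa using h.samples, h.depth.trans (by decide),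
      by simpa using h.time⟩
  | succ k ih =>
    obtain ⟨h1, h2, h3, h4⟩ := ih
    have h := iteration_cost_bounded hA hb hb1 η thr B sel Pt (fun a => Y (a, n + k))
      (iterates η thr B host sel r Pt n Y k).val
    rw [show 1 + 55 * (k + 1) = (1 + 55 * k) + 55 by ring, add_mul, add_mul _ 55 b]
    exact ⟨Nat.add_le_add h1 h.work, Nat.add_le_add h2 h.samples, max_le h3 h.depth,
      Nat.add_le_add h4 h.time⟩

theorem parallelAMDP_cost_le (hA : 1 ≤ Fintype.card (Pair A))
    (hb : ∀ w, #{a | host a = w} ≤ b) (hb1 : 1 ≤ b) (M : AMDP S A) (ε : ℝ) (n : ℕ) {N : ℕ}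
    (hN : 1 ≤ N) (sel : (Pair A → ℝ) → Pair A) (π₀ : Pair A → ℝ) (Y : Pair A × ℕ → S) :
    let c := (parallelAMDP M ε n N host sel π₀ Y).cost
    c.depth ≤ 60 ∧ c.samples ≤ 60 * (Fintype.card (Pair A) * N) ∧
      c.work ≤ 60 * (Fintype.card (Pair A) * N) ∧ c.time ≤ 60 * (b * N) := by
  intro c
  obtain ⟨h1, h2, h3, h4⟩ := iterates_cost_bounded hA hb hb1 (ε / 64) (ε / 16 + ε / 16)
    (4 * M.tmix) sel M.r (empirical n Y) n Y N
  have h := extractPolicy_cost_bounded hb π₀ (iterates (ε / 64) (ε / 16 + ε / 16)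
    (4 * M.tmix) host sel M.r (empirical n Y) n Y N).val
  -- Initialisation costs 1, each iteration 55 and the output 4 per node; `5 ≤ 5 * N` needs `1 ≤ N`.
  have key : ∀ a : ℕ, (1 + 55 * N) * a + 4 * a ≤ 60 * (a * N) := fun a => by nlinarith
  exact ⟨max_le (h3.trans (by decide)) (h.depth.trans (by decide)),
    (Nat.add_le_add h2 h.samples).trans (key _), (Nat.add_le_add h1 h.work).trans (key _),
    (Nat.add_le_add h4 h.time).trans (key _)⟩

end AlgorithmCost

/-! ### Assembly of the constants -/

theorem theorem3 :
    ∃ C₀ C K : ℝ, 0 < C₀ ∧ 0 < C ∧ 0 < K ∧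
      ∀ (S : Type) [Fintype S] [DecidableEq S] [Nonempty S]
        [MeasurableSpace S] [MeasurableSingletonClass S]
        (A : S → Type) [∀ i, Fintype (A i)] [∀ i, DecidableEq (A i)] [∀ i, Nonempty (A i)]
        (M : AMDP S A), M.Mixing →
      -- a tie-breaking rule for the argmax, and a default policy for states without samples
      ∀ (sel : (Pair A → ℝ) → Pair A), (∀ (g : Pair A → ℝ) (a : Pair A), g a ≤ g (sel g)) →
      ∀ (π₀ : Pair A → ℝ), IsPolicy π₀ →
      -- the nodes are distributed evenly among `m` workers
      ∀ (m : ℕ), 1 ≤ m → m ≤ Fintype.card (Pair A) →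
      ∀ (host : Pair A → Fin m),
        (∀ w, #{a | host a = w} ≤ ⌈(Fintype.card (Pair A) : ℝ) / m⌉₊) →
      ∀ (ε σ : ℝ), 0 < ε → 0 < σ → σ < 1 / 2 →
      -- preprocessing with accuracy `ε / 16` and confidence `σ / 2`
      ∀ (n : ℕ), C₀ * ((M.tmix : ℝ) ^ 2 *
          (Fintype.card S + Real.log (Fintype.card (Pair A) / (σ / 2))) / (ε / 16) ^ 2) ≤ n →
      ∀ (N : ℕ),
        -- the output is `ε`-optimal with probability at least `1 - σ`
        (C * ((M.tmix : ℝ) ^ 2 * Fintype.card S * Real.log (1 / σ) / ε ^ 2) ≤ N →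
          ∀ (Ω : Type*) [MeasurableSpace Ω] (μ : MeasureTheory.Measure Ω)
            [MeasureTheory.IsProbabilityMeasure μ] (X : Pair A × ℕ → Ω → S), M.IsSampler μ X →
            1 - σ ≤ μ.real {ω | M.IsEpsOptimal ε
              (parallelAMDP M ε n N host sel π₀ fun q => X q ω).val}) ∧
        -- the cost of every run
        ∀ (Y : Pair A × ℕ → S),
          (1 ≤ N →
            ((parallelAMDP M ε n N host sel π₀ Y).cost.depth : ℝ) ≤ K ∧
            ((parallelAMDP M ε n N host sel π₀ Y).cost.samples : ℝ) ≤
              K * (Fintype.card (Pair A) * N) ∧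
            ((parallelAMDP M ε n N host sel π₀ Y).cost.work : ℝ) ≤
              K * (Fintype.card (Pair A) * N) ∧
            ((parallelAMDP M ε n N host sel π₀ Y).cost.time : ℝ) ≤
              K * ((Fintype.card (Pair A) : ℝ) / m * N)) ∧
          (ε ≤ 1 →
            N = ⌈C * ((M.tmix : ℝ) ^ 2 * Fintype.card S * Real.log (1 / σ) / ε ^ 2)⌉₊ →
            ((parallelAMDP M ε n N host sel π₀ Y).cost.time : ℝ) ≤
              K * ((Fintype.card (Pair A) : ℝ) / m *
                ((M.tmix : ℝ) ^ 2 * Fintype.card S * Real.log (1 / σ) / ε ^ 2))) := by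
  -- In `K`, 120 is twice the operation count 60, for rounding up the load of a worker, and `6291456
  -- + 2` allows for rounding up `N`.
  refine ⟨32, 6291456, 120 * (6291456 + 2), by norm_num, by norm_num, by norm_num, ?_⟩
  intro S _ _ _ _ _ A _ _ _ M hM sel hsel π₀ h₀ m hm1 hm host hhost ε σ hε hσ hσ2 n hn N
  refine ⟨fun hN Ω _ μ _ X hX => measureReal_isEpsOptimal_ge hM hsel h₀ hε hσ hσ2 hn hN hX,
    fun Y => ?_⟩
  have hm0 : (0 : ℝ) < m := by exact_mod_cast hm1
  have hA : 1 ≤ Fintype.card (Pair A) := hm1.trans hm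
  have hratio : (1 : ℝ) ≤ Fintype.card (Pair A) / m := by
    rw [le_div_iff₀ hm0, one_mul]
    exact_mod_cast hm
  have hb1 : 1 ≤ ⌈(Fintype.card (Pair A) : ℝ) / m⌉₊ := Nat.one_le_ceil_iff.2 (by linarith)
  have hb : (⌈(Fintype.card (Pair A) : ℝ) / m⌉₊ : ℝ) ≤ 2 * (Fintype.card (Pair A) / m) := by
    linarith [Nat.ceil_lt_add_one (by linarith : (0 : ℝ) ≤ Fintype.card (Pair A) / m)]
  have hcost := fun hN : 1 ≤ N => parallelAMDP_cost_le hA hhost hb1 M ε n hN sel π₀ Y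
  have htime : 1 ≤ N → ((parallelAMDP M ε n N host sel π₀ Y).cost.time : ℝ) ≤
      120 * (Fintype.card (Pair A) / m * N) := fun hN => by
    calc ((parallelAMDP M ε n N host sel π₀ Y).cost.time : ℝ)
        ≤ 60 * (⌈(Fintype.card (Pair A) : ℝ) / m⌉₊ * N) := by exact_mod_cast (hcost hN).2.2.2
      _ ≤ 60 * (2 * (Fintype.card (Pair A) / m) * N) := by gcongr
      _ = _ := by ring
  constructor
  · intro hN
    obtain ⟨h1, h2, h3, -⟩ := hcost hN
    refine ⟨?_, ?_, ?_, (htime hN).trans ?_⟩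
    · have : ((parallelAMDP M ε n N host sel π₀ Y).cost.depth : ℝ) ≤ 60 := by exact_mod_cast h1
      linarith
    · refine le_trans (b := 60 * ((Fintype.card (Pair A) : ℝ) * N)) (by exact_mod_cast h2) ?_
      gcongr
      norm_num
    · refine le_trans (b := 60 * ((Fintype.card (Pair A) : ℝ) * N)) (by exact_mod_cast h3) ?_
      gcongr
      norm_num
    · gcongr
      norm_num
  · intro hε1 hN
    set z := (M.tmix : ℝ) ^ 2 * Fintype.card S * Real.log (1 / σ) / ε ^ 2 with hz
    -- This uses `ε ≤ 1` and `log (1 / σ) ≥ log 2 > 1 / 2`; the 1 added by the ceiling is then at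
    -- most `2 * z`.
    have hz1 : 1 / 2 ≤ z := by
      have ht1 : (1 : ℝ) ≤ M.tmix := by exact_mod_cast hM.one_le_tmix h₀
      have hS1 : (1 : ℝ) ≤ Fintype.card S := by exact_mod_cast Fintype.card_pos
      have hlog : 1 / 2 ≤ Real.log (1 / σ) := by
        have h1 := Real.log_two_gt_d9
        have h2 : Real.log 2 ≤ Real.log (1 / σ) :=
          Real.log_le_log (by norm_num) (by rw [le_div_iff₀ hσ]; linarith)
        linarith
      have htS : (1 : ℝ) ≤ (M.tmix : ℝ) ^ 2 * Fintype.card S := by nlinarith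
      rw [hz, le_div_iff₀ (by positivity)]
      have hsq : ε ^ 2 ≤ 1 := by nlinarith
      nlinarith
    have hNz : (N : ℝ) ≤ (6291456 + 2) * z := by
      rw [hN]
      linarith [Nat.ceil_lt_add_one (by linarith : (0 : ℝ) ≤ 6291456 * z)]
    have hN1 : 1 ≤ N := by
      rw [hN]
      exact Nat.one_le_ceil_iff.2 (by linarith)
    calc ((parallelAMDP M ε n N host sel π₀ Y).cost.time : ℝ)
        ≤ 120 * (Fintype.card (Pair A) / m * N) := htime hN1
      _ ≤ 120 * (Fintype.card (Pair A) / m * ((6291456 + 2) * z)) := by gcongr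
      _ = _ := by ring
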